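/- Let $\mathbb{R}^{4,2}$ be $\mathbb{R}^6$ with an inner product $(\cdot,\cdot)$ of signature $(-++++-)$. Let $\mathfrak p$ satisfy $(\mathfrak p,\mathfrak p)=-1$ (point sphere complex) and let $\mathfrak q\neq 0$ satisfy $(\mathfrak p,\mathfrak q)=0$ (space form vector). Let $\Sigma$ be a smooth surface ($2$-manifold) and let $\mathfrak f,\mathfrak t:\Sigma\to\mathbb{R}^{4,2}$ be smooth maps into the light cone with $(\mathfrak f,\mathfrak p)=0$, $(\mathfrak f,\mathfrak q)=-1$, $(\mathfrak t,\mathfrak p)=-1$, $(\mathfrak t,\mathfrak q)=0$, such that $\Lambda=\langle \mathfrak f,\mathfrak t\rangle$ is a Legendre immersion: $(\mathfrak s_1,\mathfrak s_2)=0$ and $(d\mathfrak s_1,\mathfrak s_2)=0$ for all sections $\mathfrak s_1,\mathfrak s_2$ of $\Lambda$, and if $d_x\mathfrak s(X)\in\Lambda(x)$ for all sections $\mathfrak s$, then $X=0$. (So $\mathfrak f$ is a surface in the space form of $\mathfrak p,\mathfrak q$ with tangent plane congruence $\mathfrak t$ and Legendre lift $\Lambda$.) A sphere $\langle\sigma\rangle\subset\Lambda(x)$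 is a curvature sphere at $x$ with curvature direction $X\neq0$ if $d_x\mathfrak s(X)\in\Lambda(x)$ for the sections $\mathfrak s$ of $\Lambda$ with $\mathfrak s(x)=\sigma$; a point $x$ is umbilic if some sphere in $\Lambda(x)$ is a curvature sphere for every direction $X\ne0$. Assume: * $\Lambda$ has no umbilic points; * $\Lambda$ is non-tubular linear Weingarten: there are real constants $a,b,c$ with $ac-b^2\neq0$ such that the two curvature spheres $\langle\sigma_1\rangle,\langle\sigma_2\rangle$ at each point satisfy $$a(\sigma_1,\mathfrak q)(\sigma_2,\mathfrak q)+b\big((\sigma_1,\mathfrak q)(\sigma_2,\mathfrak p)+(\sigma_1,\mathfrak p)(\sigma_2,\mathfrak q)\big)+c(\sigma_1,\mathfrak p)(\sigma_2,\mathfrak p)=0,$$ that is, $aK+2bH+c=0$ wherever the principal curvatures $k_i=(\sigma_i,\mathfrak q)/(\sigma_i,\mathfrak p)$ are finite, with $K=k_1k_2$ and $H=\frac{k_1+k_2}{2}$; * $\Lambda$ is channel: it envelops a smooth sphere congruence $s$ depending on one parameter only (at each point there is a direction $X\neq0$ such that the derivative in direction $X$ of any lift of $s$ lies in $s$). Let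 $\tilde{\mathfrak p}\in\operatorname{span}\{\mathfrak p,\mathfrak q\}$, $\tilde{\mathfrak p}\neq0$, and let $\tilde s$ be a smooth sphere congruence (a smooth map from $\Sigma$ to the null lines of $\mathbb{R}^{4,2}$) that is enveloped by $\Lambda$ (i.e. $\tilde s(x)\subset\Lambda(x)$ for all $x$) and takes values in the linear sphere complex $\tilde{\mathfrak p}$, i.e. $\tilde s\perp\tilde{\mathfrak p}$. Then $\tilde s$ is isothermic away from the boundary of the coincidence set $\{x\in\Sigma : \tilde s(x)=s(x)\}$. In particular it is isothermic on all of $\Sigma$ if it nowhere coincides with $s$. More precisely, around every point of $\Sigma$ outside that boundary there are curvature line coordinates $(u,v)$ of $\Lambda$ (coordinates with $(\mathfrak s_1)_u,(\mathfrak s_2)_v\in\Lambda$ for lifts $\mathfrak s_1,\mathfrak s_2$ of the curvature spheres) and a nowhere vanishing smooth lift $\tilde{\mathfrak s}$ of $\tilde s$ with $\tilde{\mathfrak s}_{uv}=0$. This is in particular a Moutard lift, $\tilde{\mathfrak s}_{uv}\parallel\tilde{\mathfrak s}$, the existence of which (locally, in suitable coordinates) is the definition of $\tilde s$ being isothermic.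 -/

import Mathlib

open scoped Manifold ContDiff Topology

noncomputable section

namespace LieSphere

/-- The inner product of signature `(-++++-)` on `ℝ^{4,2}`, that is, on `Fin 6 → ℝ`. -/
def lieInner (x y : Fin 6 → ℝ) : ℝ :=
  -(x 0 * y 0) + x 1 * y 1 + x 2 * y 2 + x 3 * y 3 + x 4 * y 4 - x 5 * y 5

/-- A point sphere complex: a unit timelike vector. -/
def IsPointSphereComplex (p : Fin 6 → ℝ) : Prop := lieInner p p = -1

/-- A space form vector for the point sphere complex `p`: a non-zero vector perpendicular to `p`
(timelike, spacelike or lightlike). -/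
def IsSpaceFormVector (p q : Fin 6 → ℝ) : Prop := q ≠ 0 ∧ lieInner p q = 0

/-- The space form `Q` of curvature `-(q, q)` determined by `p` and `q`. -/
def spaceForm (p q : Fin 6 → ℝ) : Set (Fin 6 → ℝ) :=
  {x | lieInner x x = 0 ∧ lieInner x p = 0 ∧ lieInner x q = -1}

/-- The set `T` of (oriented) planes of the space form determined by `p` and `q`. -/
def planes (p q : Fin 6 → ℝ) : Set (Fin 6 → ℝ) :=
  {x | lieInner x x = 0 ∧ lieInner x p = -1 ∧ lieInner x q = 0}

section Surfaces

variable {M : Type*} [TopologicalSpace M] [ChartedSpace (EuclideanSpace ℝ (Fin 2)) M]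

/-- The derivative `d_x s (X)` of a vector-valued function on a surface. -/
def dAt (s : M → Fin 6 → ℝ) (x : M) (X : TangentSpace (𝓡 2) x) : Fin 6 → ℝ :=
  mfderiv (𝓡 2) 𝓘(ℝ, Fin 6 → ℝ) s x X

/-- Smooth sections of a family `Λ` of subspaces of `ℝ^{4,2}`. -/
def IsSection (Λ : M → Submodule ℝ (Fin 6 → ℝ)) (s : M → Fin 6 → ℝ) : Prop :=
  ContMDiff (𝓡 2) 𝓘(ℝ, Fin 6 → ℝ) ∞ s ∧ ∀ x, s x ∈ Λ x

/-- The line congruence `Λ = ⟨f, t⟩`. -/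
def legendreLift (f t : M → Fin 6 → ℝ) (x : M) : Submodule ℝ (Fin 6 → ℝ) :=
  Submodule.span ℝ {f x, t x}

/-- Legendre immersions: `(s₁, s₂) = 0` and `(ds₁, s₂) = 0` for all sections, and a tangent
vector `X` with `ds(X) ∈ Λ` for all sections `s` vanishes. -/
structure IsLegendreImmersion (Λ : M → Submodule ℝ (Fin 6 → ℝ)) : Prop where
  isotropic : ∀ s₁ s₂, IsSection Λ s₁ → IsSection Λ s₂ → ∀ x, lieInner (s₁ x) (s₂ x) = 0
  contact : ∀ s₁ s₂, IsSection Λ s₁ → IsSection Λ s₂ →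
    ∀ (x : M) (X : TangentSpace (𝓡 2) x), lieInner (dAt s₁ x X) (s₂ x) = 0
  immersion : ∀ (x : M) (X : TangentSpace (𝓡 2) x),
    (∀ s, IsSection Λ s → dAt s x X ∈ Λ x) → X = 0

/-- A surface `f` in the space form of `p, q` with tangent plane congruence `t`, whose Legendre
lift `⟨f, t⟩` is a Legendre immersion. (If `f` is immersed the last condition just says that `t`
is tangent to `f`; points where only `f` fails to be immersed are allowed.) -/
structure IsSpaceFormSurface (p q : Fin 6 → ℝ) (f t : M → Fin 6 → ℝ) : Prop where
  smooth_f : ContMDiff (𝓡 2) 𝓘(ℝ, Fin 6 → ℝ) ∞ f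
  smooth_t : ContMDiff (𝓡 2) 𝓘(ℝ, Fin 6 → ℝ) ∞ t
  mem_spaceForm : ∀ x, f x ∈ spaceForm p q
  mem_planes : ∀ x, t x ∈ planes p q
  legendre : IsLegendreImmersion (legendreLift f t)

/-- `σ` represents a curvature sphere of `Λ` at `x`, with curvature direction `X`: some section
`s` of `Λ` through `σ` has `d_x s (X) ∈ Λ(x)`. (This does not depend on the section, as a section
vanishing at `x` has all its derivatives at `x` in `Λ(x)`.) -/
def IsCurvatureSphereAt (Λ : M → Submodule ℝ (Fin 6 → ℝ)) (x : M) (σ : Fin 6 → ℝ)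
    (X : TangentSpace (𝓡 2) x) : Prop :=
  σ ≠ 0 ∧ X ≠ 0 ∧ ∃ s, IsSection Λ s ∧ s x = σ ∧ dAt s x X ∈ Λ x

/-- No point is umbilic: at no point is there a curvature sphere for which every direction is a
curvature direction. -/
def IsUmbilicFree (Λ : M → Submodule ℝ (Fin 6 → ℝ)) : Prop :=
  ∀ x, ¬ ∃ σ, ∀ X : TangentSpace (𝓡 2) x, X ≠ 0 → IsCurvatureSphereAt Λ x σ X

/-- The linear Weingarten condition
`((σ₁,q), (σ₁,p)) W ((σ₂,q), (σ₂,p))ᵗ = 0`, `W = (a b; b c)`. -/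
def WeingartenRelation (p q : Fin 6 → ℝ) (a b c : ℝ) (σ₁ σ₂ : Fin 6 → ℝ) : Prop :=
  a * (lieInner σ₁ q * lieInner σ₂ q)
    + b * (lieInner σ₁ q * lieInner σ₂ p + lieInner σ₁ p * lieInner σ₂ q)
    + c * (lieInner σ₁ p * lieInner σ₂ p) = 0

/-- The principal curvature `k = (σ, q) / (σ, p)` belonging to a curvature sphere `⟨σ⟩`. -/
def principalCurvature (p q σ : Fin 6 → ℝ) : ℝ := lieInner σ q / lieInner σ p

/-- Where the principal curvatures are finite, the relation is `a K + 2 b H + c = 0`. -/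
theorem weingartenRelation_iff (p q : Fin 6 → ℝ) (a b c : ℝ) (σ₁ σ₂ : Fin 6 → ℝ)
    (h₁ : lieInner σ₁ p ≠ 0) (h₂ : lieInner σ₂ p ≠ 0) :
    WeingartenRelation p q a b c σ₁ σ₂ ↔
      a * (principalCurvature p q σ₁ * principalCurvature p q σ₂)
        + 2 * b * ((principalCurvature p q σ₁ + principalCurvature p q σ₂) / 2) + c = 0 := by
  unfold WeingartenRelation principalCurvature
  have key : a * (lieInner σ₁ q * lieInner σ₂ q)
      + b * (lieInner σ₁ q * lieInner σ₂ p + lieInner σ₁ p * lieInner σ₂ q)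
      + c * (lieInner σ₁ p * lieInner σ₂ p) =
      (a * (lieInner σ₁ q / lieInner σ₁ p * (lieInner σ₂ q / lieInner σ₂ p))
        + 2 * b * ((lieInner σ₁ q / lieInner σ₁ p + lieInner σ₂ q / lieInner σ₂ p) / 2) + c)
        * (lieInner σ₁ p * lieInner σ₂ p) := by
    field_simp
  rw [key, mul_eq_zero, or_iff_left (mul_ne_zero h₁ h₂)]

/-- `Λ` is non-tubular linear Weingarten with respect to `p, q`: with constants satisfying
`a c - b² ≠ 0`, the two curvature spheres at each point satisfy the linear Weingarten
condition. -/
def IsNonTubularLinearWeingarten (p q : Fin 6 → ℝ) (Λ : M → Submodule ℝ (Fin 6 → ℝ)) : Prop :=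
  ∃ a b c : ℝ, a * c - b ^ 2 ≠ 0 ∧
    ∀ (x : M) (σ₁ σ₂ : Fin 6 → ℝ) (X₁ X₂ : TangentSpace (𝓡 2) x),
      IsCurvatureSphereAt Λ x σ₁ X₁ → IsCurvatureSphereAt Λ x σ₂ X₂ →
      LinearIndependent ℝ ![σ₁, σ₂] → WeingartenRelation p q a b c σ₁ σ₂

/-- `σ` is a (smooth, nowhere vanishing, lightlike) lift over `U` of the map `S` into the Lie
quadric, whose points are regarded as one-dimensional subspaces. -/
def IsLift (S : M → Submodule ℝ (Fin 6 → ℝ)) (U : Set M) (σ : M → Fin 6 → ℝ) : Prop :=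
  ContMDiffOn (𝓡 2) 𝓘(ℝ, Fin 6 → ℝ) ∞ σ U ∧
    ∀ y ∈ U, σ y ≠ 0 ∧ lieInner (σ y) (σ y) = 0 ∧ S y = Submodule.span ℝ {σ y}

/-- Sphere congruences: smooth maps into the Lie quadric. -/
def IsSphereCongruence (S : M → Submodule ℝ (Fin 6 → ℝ)) : Prop :=
  ∀ x, ∃ U : Set M, IsOpen U ∧ x ∈ U ∧ ∃ σ, IsLift S U σ

/-- `Λ` envelops the sphere congruence `S`. -/
def Envelops (Λ S : M → Submodule ℝ (Fin 6 → ℝ)) : Prop := ∀ x, S x ≤ Λ x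

/-- `S` takes values in the linear sphere complex given by `w`. -/
def TakesValuesIn (S : M → Submodule ℝ (Fin 6 → ℝ)) (w : Fin 6 → ℝ) : Prop :=
  ∀ x, ∀ σ ∈ S x, lieInner σ w = 0

/-- The sphere congruence `S` depends on one parameter only: as a map into the Lie quadric it has
rank at most one, that is, at each point there is a direction in which the derivative of every
lift is again in `S`. -/
def IsOneParameterFamily (S : M → Submodule ℝ (Fin 6 → ℝ)) : Prop :=
  ∀ (x : M) (U : Set M) (σ : M → Fin 6 → ℝ), IsOpen U → x ∈ U → IsLift S U σ →
    ∃ X : TangentSpace (𝓡 2) x, X ≠ 0 ∧ dAt σ x X ∈ S x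

/-- `S` is an enveloped one-parameter family of spheres, exhibiting `Λ` as a channel surface. -/
structure IsChannelFamily (Λ S : M → Submodule ℝ (Fin 6 → ℝ)) : Prop where
  congruence : IsSphereCongruence S
  envelops : Envelops Λ S
  oneParameter : IsOneParameterFamily S

/-- Local coordinates `(u, v)` on the surface. -/
abbrev Coord (M : Type*) [TopologicalSpace M] : Type _ :=
  OpenPartialHomeomorph M (EuclideanSpace ℝ (Fin 2))

/-- The partial derivative in the coordinates `φ = (u, v)`, as a function of the coordinates:
`i = 0` is `∂/∂u`, `i = 1` is `∂/∂v`. -/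
def coordDeriv (φ : Coord M) (i : Fin 2) (s : M → Fin 6 → ℝ) (z : EuclideanSpace ℝ (Fin 2)) : Fin 6 → ℝ :=
  fderiv ℝ (fun w => s (φ.symm w)) z (EuclideanSpace.single i 1)

/-- The mixed second derivative `s_uv`. -/
def coordDerivUV (φ : Coord M) (s : M → Fin 6 → ℝ) (z : EuclideanSpace ℝ (Fin 2)) : Fin 6 → ℝ :=
  fderiv ℝ (coordDeriv φ 0 s) z (EuclideanSpace.single 1 1)

/-- `(u, v)` are curvature line coordinates of `Λ`: at each point there are non-zero sections
`s₁`, `s₂` of `Λ` with `(s₁)_u ∈ Λ` and `(s₂)_v ∈ Λ`. -/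
def IsCurvatureLineCoord (Λ : M → Submodule ℝ (Fin 6 → ℝ)) (φ : Coord M) : Prop :=
  ∀ z ∈ φ.target, ∀ i : Fin 2,
    ∃ s, IsSection Λ s ∧ s (φ.symm z) ≠ 0 ∧ coordDeriv φ i s z ∈ Λ (φ.symm z)

/-- `σ` is a Moutard lift of `S` in the coordinates `(u, v)`: `σ_uv ∥ σ`. -/
def IsMoutardLift (S : M → Submodule ℝ (Fin 6 → ℝ)) (φ : Coord M) (σ : M → Fin 6 → ℝ) : Prop :=
  IsLift S φ.source σ ∧
    ∀ z ∈ φ.target, ∃ r : ℝ, coordDerivUV φ σ z = r • σ (φ.symm z)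

/-- `S` is isothermic on `U`: around each point of `U` there are coordinates in which `S` has a
Moutard lift. -/
def IsIsothermicOn (S : M → Submodule ℝ (Fin 6 → ℝ)) (U : Set M) : Prop :=
  ∀ x ∈ U, ∃ φ ∈ IsManifold.maximalAtlas (𝓡 2) ∞ M, x ∈ φ.source ∧ ∃ σ, IsMoutardLift S φ σ

end Surfaces

end LieSphere

end

noncomputable section

namespace LieSphere

section ContactElement

theorem lieInner_comm (x y : Fin 6 → ℝ) : lieInner x y = lieInner y x := by
  unfold lieInner; ring

theorem lieInner_add_left (x y z : Fin 6 → ℝ) :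
    lieInner (x + y) z = lieInner x z + lieInner y z := by
  simp only [lieInner, Pi.add_apply]; ring

theorem lieInner_add_right (x y z : Fin 6 → ℝ) :
    lieInner x (y + z) = lieInner x y + lieInner x z := by
  simp only [lieInner, Pi.add_apply]; ring

theorem lieInner_smul_left (r : ℝ) (x z : Fin 6 → ℝ) :
    lieInner (r • x) z = r * lieInner x z := by
  simp only [lieInner, Pi.smul_apply, smul_eq_mul]; ring

theorem lieInner_smul_right (r : ℝ) (x z : Fin 6 → ℝ) :
    lieInner x (r • z) = r * lieInner x z := by
  simp only [lieInner, Pi.smul_apply, smul_eq_mul]; ring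

theorem lieInner_zero_left (z : Fin 6 → ℝ) : lieInner 0 z = 0 := by simp [lieInner]

theorem lieInner_zero_right (z : Fin 6 → ℝ) : lieInner z 0 = 0 := by simp [lieInner]

/-- The inner product of `ℝ^{4,2}` as a continuous bilinear map. -/
def lieForm : (Fin 6 → ℝ) →L[ℝ] (Fin 6 → ℝ) →L[ℝ] ℝ :=
  LinearMap.toContinuousLinearMap
    (LinearMap.toContinuousLinearMap.toLinearMap ∘ₗ
      LinearMap.mk₂ ℝ lieInner lieInner_add_left lieInner_smul_left lieInner_add_right
        lieInner_smul_right)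

/-- The vectors `F`, `T` represent a point of the space form of `p, q` and a plane through it. -/
structure IsContactElement (p q F T : Fin 6 → ℝ) : Prop where
  point : F ∈ spaceForm p q
  plane : T ∈ planes p q
  incident : lieInner F T = 0

/-- The orthogonal complement of the four vectors `p, q, F, T`. -/
structure IsNormalTo (p q F T z : Fin 6 → ℝ) : Prop where
  left_F : lieInner z F = 0
  left_T : lieInner z T = 0
  left_p : lieInner z p = 0
  left_q : lieInner z q = 0

variable {p q F T : Fin 6 → ℝ}

theorem IsNormalTo.add {x y : Fin 6 → ℝ} (hx : IsNormalTo p q F T x) (hy : IsNormalTo p q F T y) :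
    IsNormalTo p q F T (x + y) := by
  constructor <;>
    simp [lieInner_add_left, hx.left_F, hx.left_T, hx.left_p, hx.left_q,
      hy.left_F, hy.left_T, hy.left_p, hy.left_q]

theorem IsNormalTo.smul {x : Fin 6 → ℝ} (r : ℝ) (hx : IsNormalTo p q F T x) :
    IsNormalTo p q F T (r • x) := by
  constructor <;>
    simp [lieInner_smul_left, hx.left_F, hx.left_T, hx.left_p, hx.left_q]

theorem IsContactElement.coeff_eq_zero (h : IsContactElement p q F T) {z : Fin 6 → ℝ}
    (hz : IsNormalTo p q F T z) {r s : ℝ} (h0 : r • F + s • T + z = 0) :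
    r = 0 ∧ s = 0 ∧ z = 0 := by
  have hr := congrArg (lieInner · q) h0
  have hs := congrArg (lieInner · p) h0
  simp only [lieInner_add_left, lieInner_smul_left, h.point.2.1, h.point.2.2, h.plane.2.1,
    h.plane.2.2, hz.left_p, hz.left_q, lieInner_zero_left] at hr hs
  have hr' : r = 0 := by linarith
  have hs' : s = 0 := by linarith
  refine ⟨hr', hs', ?_⟩
  simpa [hr', hs'] using h0

/-- The orthogonal complement of `p, q, F, T` is positive definite. -/
theorem IsContactElement.normal_pos (h : IsContactElement p q F T) {z : Fin 6 → ℝ}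
    (hz : IsNormalTo p q F T z) (hz0 : z ≠ 0) : 0 < lieInner z z := by
  by_contra! hle
  have hdim : ¬ LinearIndependent ℝ ![![F 0, F 5], ![T 0, T 5], ![z 0, z 5]] := fun hli => by
    have := hli.fintype_card_le_finrank
    simp at this
  obtain ⟨g, hg, hne⟩ := Fintype.not_linearIndependent_iff.1 hdim
  have h0 := congrFun hg 0
  have h5 := congrFun hg 1
  simp [Fin.sum_univ_three] at h0 h5
  set y := g 0 • F + g 1 • T + g 2 • z with hy
  have hy0 : y 0 = 0 := by simpa [hy] using h0
  have hy5 : y 5 = 0 := by simpa [hy] using h5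
  have hyy : lieInner y y = g 2 ^ 2 * lieInner z z := by
    simp only [hy, lieInner_add_left, lieInner_add_right, lieInner_smul_left, lieInner_smul_right,
      h.point.1, h.plane.1, h.incident, hz.left_F, hz.left_T, lieInner_comm T F,
      lieInner_comm F z, lieInner_comm T z]
    ring
  have hle' : lieInner y y ≤ 0 := by
    rw [hyy]; exact mul_nonpos_of_nonneg_of_nonpos (sq_nonneg _) hle
  simp only [lieInner, hy0, hy5] at hle'
  have hyz : y = 0 := by
    have h1 : y 1 = 0 := by nlinarith [sq_nonneg (y 2), sq_nonneg (y 3), sq_nonneg (y 4)]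
    have h2 : y 2 = 0 := by nlinarith [sq_nonneg (y 1), sq_nonneg (y 3), sq_nonneg (y 4)]
    have h3 : y 3 = 0 := by nlinarith [sq_nonneg (y 1), sq_nonneg (y 2), sq_nonneg (y 4)]
    have h4 : y 4 = 0 := by nlinarith [sq_nonneg (y 1), sq_nonneg (y 2), sq_nonneg (y 3)]
    funext i
    fin_cases i <;> assumption
  obtain ⟨e0, e1, e2⟩ := h.coeff_eq_zero (hz.smul (g 2)) (hy.symm.trans hyz)
  obtain ⟨i, hi⟩ := hne
  have e2 : g 2 = 0 := (smul_eq_zero.1 e2).resolve_right hz0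
  fin_cases i <;> contradiction

theorem IsContactElement.normal_ne (h : IsContactElement p q F T) {z : Fin 6 → ℝ}
    (hz : IsNormalTo p q F T z) (hz0 : z ≠ 0) : lieInner z z ≠ 0 := (h.normal_pos hz hz0).ne'

/-- The orthogonal complement of `p, q, F, T` is two-dimensional. -/
theorem IsContactElement.normal_dim (h : IsContactElement p q F T) {c d e : Fin 6 → ℝ}
    (hc : IsNormalTo p q F T c) (hd : IsNormalTo p q F T d) (he : IsNormalTo p q F T e)
    (he0 : e ≠ 0) (hd0 : d ≠ 0) (hce : lieInner c e = 0) (hde : lieInner d e = 0) :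
    ∃ κ : ℝ, c = κ • d := by
  have hdd := h.normal_ne hd hd0
  set κ := lieInner c d / lieInner d d with hκ
  set c' := c + (-κ) • d with hc'
  have hn : IsNormalTo p q F T c' := hc.add (hd.smul _)
  refine ⟨κ, ?_⟩
  by_contra hne
  have hc0 : c' ≠ 0 := fun h0 => hne (by
    rw [hc', neg_smul, ← sub_eq_add_neg] at h0; exact sub_eq_zero.1 h0)
  have hcc := h.normal_ne hn hc0
  have hee := h.normal_ne he he0
  have hcd : lieInner c' d = 0 := by
    simp only [hc', lieInner_add_left, lieInner_smul_left, hκ]; field_simp; ring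
  have hce' : lieInner c' e = 0 := by
    simp only [hc', lieInner_add_left, lieInner_smul_left, hce, hde]; ring
  have hli : LinearIndependent ℝ ![F, T, p, q, c', d, e] := by
    rw [Fintype.linearIndependent_iff]
    intro g hg
    simp only [Fin.sum_univ_seven] at hg
    have key : ∀ y, g 0 * lieInner F y + g 1 * lieInner T y + g 2 * lieInner p y +
        g 3 * lieInner q y + g 4 * lieInner c' y + g 5 * lieInner d y + g 6 * lieInner e y = 0 := by
      intro y
      have := congrArg (lieInner · y) hg
      simpa [lieInner_add_left, lieInner_smul_left, lieInner_zero_left] using this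
    have k1 := key F
    have k2 := key T
    have k3 := key p
    have k4 := key q
    have k5 := key c'
    have k6 := key d
    have k7 := key e
    simp only [h.point.1, h.plane.1, h.incident, lieInner_comm T F, lieInner_comm p F,
      lieInner_comm q F, lieInner_comm p T, lieInner_comm q T, h.point.2.1, h.point.2.2,
      h.plane.2.1, h.plane.2.2, hn.left_F, hn.left_T, hn.left_p, hn.left_q, hd.left_F, hd.left_T,
      hd.left_p, hd.left_q, he.left_F, he.left_T, he.left_p, he.left_q, lieInner_comm F c',
      lieInner_comm T c', lieInner_comm p c', lieInner_comm q c', lieInner_comm F d,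
      lieInner_comm T d, lieInner_comm p d, lieInner_comm q d, lieInner_comm F e,
      lieInner_comm T e, lieInner_comm p e, lieInner_comm q e, hcd, hde, hce',
      lieInner_comm d c', lieInner_comm e c', lieInner_comm e d, mul_zero, add_zero,
      zero_add] at k1 k2 k3 k4 k5 k6 k7
    have g4 := (mul_eq_zero.1 k5).resolve_right hcc
    have g5 := (mul_eq_zero.1 k6).resolve_right hdd
    have g6 := (mul_eq_zero.1 k7).resolve_right hee
    have g3 : g 3 = 0 := by linarith
    have g2 : g 2 = 0 := by linarith
    rw [g2, g3] at k3 k4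
    have g0 : g 0 = 0 := by linarith
    have g1 : g 1 = 0 := by linarith
    intro i
    fin_cases i <;> assumption
  have := hli.fintype_card_le_finrank
  simp at this

theorem exists_smul_eq_of_det_eq_zero {α β r s : ℝ} (h0 : (α, β) ≠ 0) (h : α * s - β * r = 0) :
    ∃ k : ℝ, r = k * α ∧ s = k * β := by
  by_cases hα : α = 0
  · have hβ : β ≠ 0 := fun hβ => h0 (by simp [hα, hβ])
    have hr : r = 0 := by
      rcases mul_eq_zero.1 (show β * r = 0 by rw [hα] at h; linarith) with h | h
      · exact absurd h hβ
      · exact h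
    exact ⟨s / β, by simp [hα, hr], by field_simp⟩
  · exact ⟨r / α, by field_simp, by field_simp; linarith⟩

theorem eq_zero_of_smul_add_smul_eq_zero {V : Type*} [AddCommGroup V] [Module ℝ V] {α β r s : ℝ}
    {x y : V} (h : α * s - β * r ≠ 0) (h₁ : α • x + β • y = 0) (h₂ : r • x + s • y = 0) :
    x = 0 ∧ y = 0 := by
  have hx : (α * s - β * r) • x = 0 := by
    have : (α * s - β * r) • x = s • (α • x + β • y) - β • (r • x + s • y) := by module
    rw [this, h₁, h₂, smul_zero, smul_zero, sub_zero]
  have hy : (α * s - β * r) • y = 0 := by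
    have : (α * s - β * r) • y = α • (r • x + s • y) - r • (α • x + β • y) := by module
    rw [this, h₁, h₂, smul_zero, smul_zero, sub_zero]
  exact ⟨(smul_eq_zero.1 hx).resolve_left h, (smul_eq_zero.1 hy).resolve_left h⟩

/-- The infinitesimal data of a Legendre immersion at a point: the derivatives `A = df`,
`B = dt`. -/
structure IsContactDerivative {E : Type*} [AddCommGroup E] [Module ℝ E]
    (p q F T : Fin 6 → ℝ) (A B : E →ₗ[ℝ] Fin 6 → ℝ) : Prop where
  contact : IsContactElement p q F T
  normal_left : ∀ X, IsNormalTo p q F T (A X)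
  normal_right : ∀ X, IsNormalTo p q F T (B X)
  symm : ∀ X Y, lieInner (A X) (B Y) = lieInner (A Y) (B X)
  immersion : ∀ X, A X = 0 → B X = 0 → X = 0

/-- At a point which is not umbilic, the existence of one curvature sphere entails that of
another one. -/
theorem IsContactDerivative.exists_second {E : Type*} [AddCommGroup E] [Module ℝ E]
    {A B : E →ₗ[ℝ] Fin 6 → ℝ} (h : IsContactDerivative p q F T A B)
    {α β : ℝ} (h0 : (α, β) ≠ 0)
    {X Z : E} (hX0 : X ≠ 0) (hX : α • A X + β • B X = 0) (hZ : α • A Z + β • B Z ≠ 0) :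
    ∃ Y : E, Y ≠ 0 ∧ ∃ r s : ℝ, r • A Y + s • B Y = 0 ∧ α * s - β * r ≠ 0 := by
  have hpos : 0 < α ^ 2 + β ^ 2 := by
    by_contra! hle
    exact h0 (Prod.ext (by simp; nlinarith [sq_nonneg α, sq_nonneg β])
      (by simp; nlinarith [sq_nonneg α, sq_nonneg β]))
  set e := (-β) • A X + α • B X with he
  set d := α • A Z + β • B Z with hd
  have heN : IsNormalTo p q F T e := ((h.normal_left X).smul _).add ((h.normal_right X).smul _)
  have hdN : IsNormalTo p q F T d := ((h.normal_left Z).smul _).add ((h.normal_right Z).smul _)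
  have he0 : e ≠ 0 := fun he0 => by
    obtain ⟨h1, h2⟩ := eq_zero_of_smul_add_smul_eq_zero
      (by nlinarith : α * α - β * (-β) ≠ 0) hX he0
    exact hX0 (h.immersion X h1 h2)
  have hee := h.contact.normal_ne heN he0
  have h1 : α * lieInner (A X) (A Z) + β * lieInner (A Z) (B X) = 0 := by
    have := congrArg (lieInner · (A Z)) hX
    simpa [lieInner_add_left, lieInner_smul_left, lieInner_zero_left,
      lieInner_comm (B X) (A Z)] using this
  have h2 : α * lieInner (A X) (B Z) + β * lieInner (B X) (B Z) = 0 := by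
    have := congrArg (lieInner · (B Z)) hX
    simpa [lieInner_add_left, lieInner_smul_left, lieInner_zero_left] using this
  have hde : lieInner d e = 0 := by
    simp only [hd, he, lieInner_add_left, lieInner_add_right, lieInner_smul_left,
      lieInner_smul_right, lieInner_comm (A Z) (A X), lieInner_comm (B Z) (A X),
      lieInner_comm (B Z) (B X)]
    linear_combination (-β) * h1 + α * h2 + (α ^ 2 + β ^ 2) * h.symm Z X
  set k := lieInner ((-β) • A Z + α • B Z) e / lieInner e e with hk
  set Y := Z + (-k) • X with hY
  set c := (-β) • A Y + α • B Y with hc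
  have hcN : IsNormalTo p q F T c := ((h.normal_left Y).smul _).add ((h.normal_right Y).smul _)
  have hcZ : c = ((-β) • A Z + α • B Z) + (-k) • e := by
    simp only [hc, hY, he, map_add, map_smul]; module
  have hce : lieInner c e = 0 := by
    rw [hcZ, lieInner_add_left, lieInner_smul_left, hk]; field_simp; ring
  obtain ⟨κ, hκ⟩ := h.contact.normal_dim hcN hdN heN he0 hZ hce hde
  have hdY : d = α • A Y + β • B Y := by
    have : α • A Y + β • B Y = d + (-k) • (α • A X + β • B X) := by
      simp only [hd, hY, map_add, map_smul]; module
    rw [this, hX, smul_zero, add_zero]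
  refine ⟨Y, fun hY0 => hZ (by rw [hdY, hY0]; simp), -β - κ * α, α - κ * β, ?_, by nlinarith⟩
  have : c - κ • d = 0 := sub_eq_zero.2 hκ
  rw [hdY, hc] at this
  rw [← this]; module

/-- The linear Weingarten condition in terms of the coefficients of the spheres with respect
to `f` and `t`. -/
def CoeffRelation (a b c α₁ β₁ α₂ β₂ : ℝ) : Prop :=
  a * (α₁ * α₂) + b * (α₁ * β₂ + β₁ * α₂) + c * (β₁ * β₂) = 0

/-- The quadratic form of the linear Weingarten condition. -/
def weingartenForm (a b c α β : ℝ) : ℝ := a * α ^ 2 + 2 * b * (α * β) + c * β ^ 2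

/-- At a point of a non-tubular linear Weingarten surface no curvature sphere is isotropic for the
Weingarten form, and one curvature sphere determines the other one. -/
theorem CoeffRelation.form_ne_zero {a b c α β r s : ℝ} (hdet : a * c - b ^ 2 ≠ 0)
    (h0 : (α, β) ≠ 0) (hrs : α * s - β * r ≠ 0) (h : CoeffRelation a b c α β r s) :
    weingartenForm a b c α β ≠ 0 ∧
      ∃ k : ℝ, b * α + c * β = k * r ∧ -(a * α + b * β) = k * s := by
  unfold CoeffRelation at h
  unfold weingartenForm
  constructor
  · intro hQ
    have e1 : (a * α + b * β) * (α * s - β * r) = 0 := by linear_combination s * hQ - β * h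
    have e2 : (b * α + c * β) * (α * s - β * r) = 0 := by linear_combination α * h - r * hQ
    have e1 := (mul_eq_zero.1 e1).resolve_right hrs
    have e2 := (mul_eq_zero.1 e2).resolve_right hrs
    have e3 : (a * c - b ^ 2) * α = 0 := by linear_combination c * e1 - b * e2
    have e4 : (a * c - b ^ 2) * β = 0 := by linear_combination a * e2 - b * e1
    exact h0 (Prod.ext ((mul_eq_zero.1 e3).resolve_left hdet)
      ((mul_eq_zero.1 e4).resolve_left hdet))
  · refine exists_smul_eq_of_det_eq_zero (fun h => hrs ?_) (by linear_combination -h)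
    obtain ⟨h1, h2⟩ := Prod.ext_iff.1 h
    simp only [Prod.fst_zero, Prod.snd_zero] at h1 h2
    rw [h1, h2]; ring

end ContactElement

section Calculus

variable {E : Type*} [NormedAddCommGroup E] [NormedSpace ℝ E]

theorem lieInner_fderiv_add_eq_zero {U : Set E} (hU : IsOpen U) {A B : E → Fin 6 → ℝ} {z : E}
    (hz : z ∈ U) (hA : DifferentiableAt ℝ A z) (hB : DifferentiableAt ℝ B z) {k : ℝ}
    (h : ∀ y ∈ U, lieInner (A y) (B y) = k) (X : E) :
    lieInner (fderiv ℝ A z X) (B z) + lieInner (A z) (fderiv ℝ B z X) = 0 := by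
  have h1 := lieForm.hasFDerivAt_of_bilinear hA.hasFDerivAt hB.hasFDerivAt
  have h2 : (fun y => lieForm (A y) (B y)) =ᶠ[𝓝 z] fun _ => k := by
    filter_upwards [hU.mem_nhds hz] with y hy using h y hy
  have h3 := h1.unique ((hasFDerivAt_const k z).congr_of_eventuallyEq h2)
  have h4 := congrArg (fun L => L X) h3
  change lieInner (A z) (fderiv ℝ B z X) + lieInner (fderiv ℝ A z X) (B z) = 0 at h4
  linarith

theorem fderiv_smul_add_smul {α β : E → ℝ} {A B : E → Fin 6 → ℝ} {z : E}
    (hα : DifferentiableAt ℝ α z) (hβ : DifferentiableAt ℝ β z) (hA : DifferentiableAt ℝ A z)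
    (hB : DifferentiableAt ℝ B z) (Z : E) :
    fderiv ℝ (fun y => α y • A y + β y • B y) z Z =
      fderiv ℝ α z Z • A z + fderiv ℝ β z Z • B z +
        (α z • fderiv ℝ A z Z + β z • fderiv ℝ B z Z) := by
  have hd : fderiv ℝ (fun y => α y • A y + β y • B y) z = _ :=
    ((hα.hasFDerivAt.smul hA.hasFDerivAt).add (hβ.hasFDerivAt.smul hB.hasFDerivAt)).fderiv
  rw [hd]
  simp
  module

/-- The inverse function theorem for smooth self-maps of a finite-dimensional space. -/
theorem exists_openPartialHomeomorph_of_injective_fderiv [FiniteDimensional ℝ E] {U : Set E} (hU : IsOpen U) {Φ : E → E}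
    (hΦ : ContDiffOn ℝ ∞ Φ U) {z : E} (hz : z ∈ U) (hinj : Function.Injective (fderiv ℝ Φ z)) :
    ∃ ψ : OpenPartialHomeomorph E E, z ∈ ψ.source ∧ ψ.source ⊆ U ∧ ⇑ψ = Φ ∧
      ContDiffOn ℝ ∞ ψ.symm ψ.target := by
  have : CompleteSpace E := FiniteDimensional.complete ℝ E
  have hA : ∀ y ∈ U, ContDiffAt ℝ ∞ Φ y := fun y hy => hΦ.contDiffAt (hU.mem_nhds hy)
  let L : E ≃L[ℝ] E :=
    (LinearEquiv.ofInjectiveEndo (fderiv ℝ Φ z).toLinearMap hinj).toContinuousLinearEquiv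
  have hL : (L : E →L[ℝ] E) = fderiv ℝ Φ z := by ext; rfl
  have hd : HasFDerivAt Φ (L : E →L[ℝ] E) z := by
    rw [hL]; exact ((hA z hz).differentiableAt (by simp)).hasFDerivAt
  set S : Set (E →L[ℝ] E) := Set.range ((↑) : (E ≃L[ℝ] E) → E →L[ℝ] E) with hS
  have hSo : IsOpen S := ContinuousLinearEquiv.isOpen
  have hcont : ContinuousOn (fderiv ℝ Φ) U := fun y hy =>
    ((hA y hy).fderiv_right (m := ∞) (by simp)).continuousAt.continuousWithinAt
  set V := U ∩ fderiv ℝ Φ ⁻¹' S with hV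
  have hVo : IsOpen V := hcont.isOpen_inter_preimage hU hSo
  set e := (hA z hz).toOpenPartialHomeomorph Φ hd (by simp) with he
  have hez : z ∈ e.source := (hA z hz).mem_toOpenPartialHomeomorph_source hd (by simp)
  refine ⟨e.restrOpen V hVo, ⟨hez, hz, L, hL⟩, fun y hy => hy.2.1, rfl, fun w hw => ?_⟩
  have hw' := (e.restrOpen V hVo).map_target hw
  obtain ⟨hyU, L', hL'⟩ := hw'.2
  refine ((e.restrOpen V hVo).contDiffAt_symm hw (f₀' := L') ?_ (hA _ hyU)).contDiffWithinAt
  rw [hL']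
  exact ((hA _ hyU).differentiableAt (by simp)).hasFDerivAt

end Calculus

/-- A Legendre immersion `⟨F, T⟩` over an open set `U` of the plane which has no umbilic points and
is linear Weingarten. -/
structure IsWeingartenPatch (p q : Fin 6 → ℝ) (a b c : ℝ)
    (U : Set (EuclideanSpace ℝ (Fin 2))) (F T : EuclideanSpace ℝ (Fin 2) → Fin 6 → ℝ) : Prop where
  isOpen : IsOpen U
  smooth_F : ContDiffOn ℝ ∞ F U
  smooth_T : ContDiffOn ℝ ∞ T U
  element : ∀ z ∈ U, IsContactElement p q (F z) (T z)
  contact : ∀ z ∈ U, ∀ X, lieInner (fderiv ℝ F z X) (T z) = 0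
  immersion : ∀ z ∈ U, ∀ X, fderiv ℝ F z X = 0 → fderiv ℝ T z X = 0 → X = 0
  umbilicFree : ∀ z ∈ U, ∀ r s : ℝ, (r, s) ≠ 0 →
    ∃ X, r • fderiv ℝ F z X + s • fderiv ℝ T z X ≠ 0
  det_ne_zero : a * c - b ^ 2 ≠ 0
  weingarten : ∀ z ∈ U, ∀ (r₁ s₁ r₂ s₂ : ℝ) (X₁ X₂ : EuclideanSpace ℝ (Fin 2)),
    X₁ ≠ 0 → X₂ ≠ 0 → r₁ • fderiv ℝ F z X₁ + s₁ • fderiv ℝ T z X₁ = 0 →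
    r₂ • fderiv ℝ F z X₂ + s₂ • fderiv ℝ T z X₂ = 0 → r₁ * s₂ - s₁ * r₂ ≠ 0 →
    CoeffRelation a b c r₁ s₁ r₂ s₂

/-- A patch of a linear Weingarten surface which envelops the one-parameter family of spheres
`⟨α F + β T⟩`. -/
structure IsChannelWeingartenPatch (p q : Fin 6 → ℝ) (a b c : ℝ)
    (U : Set (EuclideanSpace ℝ (Fin 2))) (F T : EuclideanSpace ℝ (Fin 2) → Fin 6 → ℝ)
    (α β : EuclideanSpace ℝ (Fin 2) → ℝ) : Prop extends IsWeingartenPatch p q a b c U F T where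
  smooth_α : ContDiffOn ℝ ∞ α U
  smooth_β : ContDiffOn ℝ ∞ β U
  coeff_ne_zero : ∀ z ∈ U, (α z, β z) ≠ 0
  channel : ∀ z ∈ U, ∃ X, X ≠ 0 ∧ α z • fderiv ℝ F z X + β z • fderiv ℝ T z X = 0 ∧
    ∃ k : ℝ, fderiv ℝ α z X = k * α z ∧ fderiv ℝ β z X = k * β z

namespace IsWeingartenPatch

variable {p q : Fin 6 → ℝ} {a b c : ℝ} {U : Set (EuclideanSpace ℝ (Fin 2))}
  {F T : EuclideanSpace ℝ (Fin 2) → Fin 6 → ℝ} {z : EuclideanSpace ℝ (Fin 2)}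

theorem mono (h : IsWeingartenPatch p q a b c U F T)
    {V : Set (EuclideanSpace ℝ (Fin 2))} (hV : IsOpen V) (hVU : V ⊆ U) :
    IsWeingartenPatch p q a b c V F T where
  isOpen := hV
  smooth_F := h.smooth_F.mono hVU
  smooth_T := h.smooth_T.mono hVU
  element z hz := h.element z (hVU hz)
  contact z hz := h.contact z (hVU hz)
  immersion z hz := h.immersion z (hVU hz)
  umbilicFree z hz := h.umbilicFree z (hVU hz)
  det_ne_zero := h.det_ne_zero
  weingarten z hz := h.weingarten z (hVU hz)

theorem contDiffAt_F (h : IsWeingartenPatch p q a b c U F T) (hz : z ∈ U) :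
    ContDiffAt ℝ ∞ F z := h.smooth_F.contDiffAt (h.isOpen.mem_nhds hz)

theorem contDiffAt_T (h : IsWeingartenPatch p q a b c U F T) (hz : z ∈ U) :
    ContDiffAt ℝ ∞ T z := h.smooth_T.contDiffAt (h.isOpen.mem_nhds hz)

theorem differentiableAt_F (h : IsWeingartenPatch p q a b c U F T) (hz : z ∈ U) :
    DifferentiableAt ℝ F z := (h.contDiffAt_F hz).differentiableAt (by simp)

theorem differentiableAt_T (h : IsWeingartenPatch p q a b c U F T) (hz : z ∈ U) :
    DifferentiableAt ℝ T z := (h.contDiffAt_T hz).differentiableAt (by simp)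

theorem contDiffAt_fderiv_F (h : IsWeingartenPatch p q a b c U F T) (hz : z ∈ U) :
    ContDiffAt ℝ ∞ (fderiv ℝ F) z := (h.contDiffAt_F hz).fderiv_right (by simp)

theorem contDiffAt_fderiv_T (h : IsWeingartenPatch p q a b c U F T) (hz : z ∈ U) :
    ContDiffAt ℝ ∞ (fderiv ℝ T) z := (h.contDiffAt_T hz).fderiv_right (by simp)

theorem normal_F (h : IsWeingartenPatch p q a b c U F T) (hz : z ∈ U)
    (X : EuclideanSpace ℝ (Fin 2)) : IsNormalTo p q (F z) (T z) (fderiv ℝ F z X) where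
  left_F := by
    have := lieInner_fderiv_add_eq_zero h.isOpen hz (h.differentiableAt_F hz)
      (h.differentiableAt_F hz) (fun y hy => (h.element y hy).point.1) X
    rw [lieInner_comm (F z)] at this
    linarith
  left_T := h.contact z hz X
  left_p := by
    have := lieInner_fderiv_add_eq_zero h.isOpen hz (h.differentiableAt_F hz)
      (differentiableAt_const p) (fun y hy => (h.element y hy).point.2.1) X
    simpa [lieInner_zero_right] using this
  left_q := by
    have := lieInner_fderiv_add_eq_zero h.isOpen hz (h.differentiableAt_F hz)
      (differentiableAt_const q) (fun y hy => (h.element y hy).point.2.2) X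
    simpa [lieInner_zero_right] using this

theorem normal_T (h : IsWeingartenPatch p q a b c U F T) (hz : z ∈ U)
    (X : EuclideanSpace ℝ (Fin 2)) : IsNormalTo p q (F z) (T z) (fderiv ℝ T z X) where
  left_F := by
    have := lieInner_fderiv_add_eq_zero h.isOpen hz (h.differentiableAt_F hz)
      (h.differentiableAt_T hz) (fun y hy => (h.element y hy).incident) X
    rw [h.contact z hz, lieInner_comm (F z)] at this
    linarith
  left_T := by
    have := lieInner_fderiv_add_eq_zero h.isOpen hz (h.differentiableAt_T hz)
      (h.differentiableAt_T hz) (fun y hy => (h.element y hy).plane.1) X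
    rw [lieInner_comm (T z)] at this
    linarith
  left_p := by
    have := lieInner_fderiv_add_eq_zero h.isOpen hz (h.differentiableAt_T hz)
      (differentiableAt_const p) (fun y hy => (h.element y hy).plane.2.1) X
    simpa [lieInner_zero_right] using this
  left_q := by
    have := lieInner_fderiv_add_eq_zero h.isOpen hz (h.differentiableAt_T hz)
      (differentiableAt_const q) (fun y hy => (h.element y hy).plane.2.2) X
    simpa [lieInner_zero_right] using this

theorem symm_F (h : IsWeingartenPatch p q a b c U F T) (hz : z ∈ U)
    (X Y : EuclideanSpace ℝ (Fin 2)) :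
    fderiv ℝ (fderiv ℝ F) z X Y = fderiv ℝ (fderiv ℝ F) z Y X :=
  (h.contDiffAt_F hz).isSymmSndFDerivAt (by simp; exact ENat.LEInfty.out) X Y

theorem symm_T (h : IsWeingartenPatch p q a b c U F T) (hz : z ∈ U)
    (X Y : EuclideanSpace ℝ (Fin 2)) :
    fderiv ℝ (fderiv ℝ T) z X Y = fderiv ℝ (fderiv ℝ T) z Y X :=
  (h.contDiffAt_T hz).isSymmSndFDerivAt (by simp; exact ENat.LEInfty.out) X Y

theorem isContactDerivative (h : IsWeingartenPatch p q a b c U F T) (hz : z ∈ U) :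
    IsContactDerivative p q (F z) (T z) (fderiv ℝ F z).toLinearMap
      (fderiv ℝ T z).toLinearMap where
  contact := h.element z hz
  normal_left X := h.normal_F hz X
  normal_right X := h.normal_T hz X
  immersion X := h.immersion z hz X
  symm X Y := by
    have hd := (h.contDiffAt_fderiv_F hz).differentiableAt (by simp)
    have key : ∀ X Y, lieInner (fderiv ℝ (fderiv ℝ F) z Y X) (T z) +
        lieInner (fderiv ℝ F z X) (fderiv ℝ T z Y) = 0 := fun X Y => by
      have := lieInner_fderiv_add_eq_zero h.isOpen hz
        (hd.clm_apply (differentiableAt_const X)) (h.differentiableAt_T hz)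
        (fun y hy => h.contact y hy X) Y
      rw [fderiv_clm_apply hd (differentiableAt_const X)] at this
      simpa using this
    have h1 := key X Y
    have h2 := key Y X
    rw [h.symm_F hz] at h1
    simp only [ContinuousLinearMap.coe_coe]
    linarith

end IsWeingartenPatch

namespace IsChannelWeingartenPatch

variable {p q : Fin 6 → ℝ} {a b c ε : ℝ} {U : Set (EuclideanSpace ℝ (Fin 2))}
  {F T : EuclideanSpace ℝ (Fin 2) → Fin 6 → ℝ} {α β : EuclideanSpace ℝ (Fin 2) → ℝ}
  {z : EuclideanSpace ℝ (Fin 2)}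

theorem mono (h : IsChannelWeingartenPatch p q a b c U F T α β)
    {V : Set (EuclideanSpace ℝ (Fin 2))} (hV : IsOpen V) (hVU : V ⊆ U) :
    IsChannelWeingartenPatch p q a b c V F T α β where
  toIsWeingartenPatch := h.toIsWeingartenPatch.mono hV hVU
  smooth_α := h.smooth_α.mono hVU
  smooth_β := h.smooth_β.mono hVU
  coeff_ne_zero z hz := h.coeff_ne_zero z (hVU hz)
  channel z hz := h.channel z (hVU hz)

theorem contDiffAt_α (h : IsChannelWeingartenPatch p q a b c U F T α β) (hz : z ∈ U) :
    ContDiffAt ℝ ∞ α z := h.smooth_α.contDiffAt (h.isOpen.mem_nhds hz)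

theorem contDiffAt_β (h : IsChannelWeingartenPatch p q a b c U F T α β) (hz : z ∈ U) :
    ContDiffAt ℝ ∞ β z := h.smooth_β.contDiffAt (h.isOpen.mem_nhds hz)

theorem differentiableAt_α (h : IsChannelWeingartenPatch p q a b c U F T α β) (hz : z ∈ U) :
    DifferentiableAt ℝ α z := (h.contDiffAt_α hz).differentiableAt (by simp)

theorem differentiableAt_β (h : IsChannelWeingartenPatch p q a b c U F T α β) (hz : z ∈ U) :
    DifferentiableAt ℝ β z := (h.contDiffAt_β hz).differentiableAt (by simp)

/-- The two curvature directions at a point. -/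
structure IsPrincipalFrame (a b c : ℝ) (F T : EuclideanSpace ℝ (Fin 2) → Fin 6 → ℝ)
    (α β : EuclideanSpace ℝ (Fin 2) → ℝ) (z X Y : EuclideanSpace ℝ (Fin 2)) : Prop where
  first : α z • fderiv ℝ F z X + β z • fderiv ℝ T z X = 0
  second : (b * α z + c * β z) • fderiv ℝ F z Y + (-(a * α z + b * β z)) • fderiv ℝ T z Y = 0
  proportional : ∃ k : ℝ, fderiv ℝ α z X = k * α z ∧ fderiv ℝ β z X = k * β z
  first_ne : α z • fderiv ℝ F z Y + β z • fderiv ℝ T z Y ≠ 0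
  second_ne : (b * α z + c * β z) • fderiv ℝ F z X + (-(a * α z + b * β z)) • fderiv ℝ T z X ≠ 0
  span : ∀ Z, ∃ x y : ℝ, Z = x • X + y • Y

theorem exists_frame (h : IsChannelWeingartenPatch p q a b c U F T α β) (hz : z ∈ U) :
    weingartenForm a b c (α z) (β z) ≠ 0 ∧ ∃ X Y, IsPrincipalFrame a b c F T α β z X Y := by
  obtain ⟨X, hX0, hX, hk⟩ := h.channel z hz
  have h0 := h.coeff_ne_zero z hz
  obtain ⟨Z, hZ⟩ := h.umbilicFree z hz _ _ h0
  obtain ⟨Y, hY0, r, s, hY, hdet⟩ :=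
    (h.isContactDerivative hz).exists_second h0 hX0 hX hZ
  simp only [ContinuousLinearMap.coe_coe] at hY
  obtain ⟨hQ, k, hk1, hk2⟩ :=
    (h.weingarten z hz _ _ _ _ X Y hX0 hY0 hX hY hdet).form_ne_zero h.det_ne_zero h0 hdet
  have hdet2 : α z * (-(a * α z + b * β z)) - β z * (b * α z + c * β z) ≠ 0 := by
    intro h'; apply hQ; unfold weingartenForm; linarith
  have hsec : (b * α z + c * β z) • fderiv ℝ F z Y +
      (-(a * α z + b * β z)) • fderiv ℝ T z Y = 0 := by
    rw [hk1, hk2, mul_smul, mul_smul, ← smul_add, hY, smul_zero]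
  have hne : ∀ W, W ≠ 0 → α z • fderiv ℝ F z W + β z • fderiv ℝ T z W = 0 →
      (b * α z + c * β z) • fderiv ℝ F z W + (-(a * α z + b * β z)) • fderiv ℝ T z W = 0 →
      False := fun W hW h1 h2 => by
    obtain ⟨h3, h4⟩ := eq_zero_of_smul_add_smul_eq_zero hdet2 h1 h2
    exact hW (h.immersion z hz W h3 h4)
  have hfirst := fun h1 => hne Y hY0 h1 hsec
  refine ⟨hQ, X, Y, hX, hsec, hk, hfirst, fun h2 => hne X hX0 hX h2, ?_⟩
  have hli : LinearIndependent ℝ ![X, Y] := by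
    rw [LinearIndependent.pair_iff' hX0]
    intro x hx
    apply hfirst
    rw [← hx, map_smul, map_smul, smul_comm (α z), smul_comm (β z), ← smul_add, hX, smul_zero]
  have htop := hli.span_eq_top_of_card_eq_finrank (by simp)
  intro W
  have hW : W ∈ Submodule.span ℝ (Set.range ![X, Y]) := htop ▸ Submodule.mem_top
  rw [Matrix.range_cons, Matrix.range_cons, Matrix.range_empty, Set.union_empty,
    Set.singleton_union, Submodule.mem_span_pair] at hW
  obtain ⟨x, y, hxy⟩ := hW
  exact ⟨x, y, hxy.symm⟩

theorem contDiffAt_form (h : IsChannelWeingartenPatch p q a b c U F T α β) (hz : z ∈ U) :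
    ContDiffAt ℝ ∞ (fun z => weingartenForm a b c (α z) (β z)) z := by
  have hα := h.contDiffAt_α hz
  have hβ := h.contDiffAt_β hz
  unfold weingartenForm
  fun_prop

/-- The lift of the channel spheres can locally be rescaled so that the Weingarten form is
constant along it. -/
theorem exists_normalized (h : IsChannelWeingartenPatch p q a b c U F T α β) (hz : z ∈ U) :
    ∃ ε : ℝ, ε ≠ 0 ∧ ∃ V ⊆ U, z ∈ V ∧ ∃ ρ : EuclideanSpace ℝ (Fin 2) → ℝ, (∀ y ∈ V, ρ y ≠ 0) ∧
      IsChannelWeingartenPatch p q a b c V F T (fun y => ρ y * α y) (fun y => ρ y * β y) ∧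
      ∀ y ∈ V, weingartenForm a b c (ρ y * α y) (ρ y * β y) = ε := by
  set Q := fun y => weingartenForm a b c (α y) (β y) with hQ
  have hQz : Q z ≠ 0 := (h.exists_frame hz).1
  have hcont : ContinuousOn (fun y => (Q z)⁻¹ * Q y) U := fun y hy =>
    (continuousAt_const.mul (h.contDiffAt_form hy).continuousAt).continuousWithinAt
  set V := U ∩ (fun y => (Q z)⁻¹ * Q y) ⁻¹' Set.Ioi 0 with hV
  have hVo : IsOpen V := hcont.isOpen_inter_preimage h.isOpen isOpen_Ioi
  have hVU : V ⊆ U := Set.inter_subset_left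
  have hpos : ∀ y ∈ V, 0 < (Q z)⁻¹ * Q y := fun y hy => hy.2
  set ρ := fun y => (√((Q z)⁻¹ * Q y))⁻¹ with hρ
  have hρ0 : ∀ y ∈ V, ρ y ≠ 0 := fun y hy => inv_ne_zero (Real.sqrt_pos.2 (hpos y hy)).ne'
  have hρs : ContDiffOn ℝ ∞ ρ V := fun y hy =>
    (((contDiffAt_const.mul (h.contDiffAt_form (hVU hy))).sqrt (hpos y hy).ne').inv
      (Real.sqrt_pos.2 (hpos y hy)).ne').contDiffWithinAt
  have hm := h.mono hVo hVU
  refine ⟨Q z, hQz, V, hVU, ⟨hz, by simp [hQz]⟩, ρ, hρ0, { hm with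
      smooth_α := hρs.mul hm.smooth_α
      smooth_β := hρs.mul hm.smooth_β
      coeff_ne_zero := fun y hy h0 => hm.coeff_ne_zero y hy ?_
      channel := fun y hy => ?_ }, fun y hy => ?_⟩
  · obtain ⟨h1, h2⟩ := Prod.ext_iff.1 h0
    exact Prod.ext ((mul_eq_zero.1 h1).resolve_left (hρ0 y hy))
      ((mul_eq_zero.1 h2).resolve_left (hρ0 y hy))
  · obtain ⟨X, hX0, hX, k, hk1, hk2⟩ := hm.channel y hy
    have hρd : DifferentiableAt ℝ ρ y :=
      (hρs.contDiffAt (hVo.mem_nhds hy)).differentiableAt (by simp)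
    refine ⟨X, hX0, ?_, k + fderiv ℝ ρ y X / ρ y, ?_, ?_⟩
    · rw [mul_smul, mul_smul, ← smul_add, hX, smul_zero]
    · rw [fderiv_fun_mul hρd (hm.differentiableAt_α hy)]
      simp [hk1]
      field_simp [hρ0 y hy]
    · rw [fderiv_fun_mul hρd (hm.differentiableAt_β hy)]
      simp [hk2]
      field_simp [hρ0 y hy]
  · have h1 : weingartenForm a b c (ρ y * α y) (ρ y * β y) = (ρ y) ^ 2 * Q y := by
      simp only [hQ, weingartenForm]; ring
    have hQy : Q y ≠ 0 := fun h0 => by have := hpos y hy; simp [h0] at this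
    rw [h1, hρ]
    simp only
    rw [inv_pow, Real.sq_sqrt (hpos y hy).le]
    field_simp

theorem form_fderiv (h : IsChannelWeingartenPatch p q a b c U F T α β)
    (hε : ∀ y ∈ U, weingartenForm a b c (α y) (β y) = ε) (hz : z ∈ U)
    (Z : EuclideanSpace ℝ (Fin 2)) :
    (a * α z + b * β z) * fderiv ℝ α z Z + (b * α z + c * β z) * fderiv ℝ β z Z = 0 := by
  have hα := (h.differentiableAt_α hz).hasFDerivAt
  have hβ := (h.differentiableAt_β hz).hasFDerivAt
  have h1 := (((hα.mul hα).const_mul a).add ((hα.mul hβ).const_mul (2 * b))).add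
    ((hβ.mul hβ).const_mul c)
  have h2 : (fun y => a * (α y * α y) + 2 * b * (α y * β y) + c * (β y * β y)) =ᶠ[𝓝 z]
      fun _ => ε := by
    filter_upwards [h.isOpen.mem_nhds hz] with y hy
    rw [← hε y hy, weingartenForm]; ring
  have h3 := h1.unique ((hasFDerivAt_const ε z).congr_of_eventuallyEq h2)
  have h4 := congrArg (fun L => L Z) h3
  simp at h4
  linarith

theorem fderiv_first (h : IsChannelWeingartenPatch p q a b c U F T α β)
    (hε : ∀ y ∈ U, weingartenForm a b c (α y) (β y) = ε) (hz : z ∈ U)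
    {X Y : EuclideanSpace ℝ (Fin 2)} (hX : IsPrincipalFrame a b c F T α β z X Y) :
    fderiv ℝ α z X = 0 ∧ fderiv ℝ β z X = 0 := by
  obtain ⟨k, h1, h2⟩ := hX.proportional
  have h3 := h.form_fderiv hε hz X
  rw [h1, h2] at h3
  have hQ := (h.exists_frame hz).1
  have h4 : k * weingartenForm a b c (α z) (β z) = 0 := by
    rw [← h3, weingartenForm]; ring
  have hk : k = 0 := (mul_eq_zero.1 h4).resolve_right hQ
  simp [h1, h2, hk]

/-- The one-form whose kernel is the curvature direction of the second curvature sphere. -/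
def secondForm (a b c : ℝ) (F T : EuclideanSpace ℝ (Fin 2) → Fin 6 → ℝ)
    (α β : EuclideanSpace ℝ (Fin 2) → ℝ) (z : EuclideanSpace ℝ (Fin 2)) :
    EuclideanSpace ℝ (Fin 2) →L[ℝ] Fin 6 → ℝ :=
  (b * α z + c * β z) • fderiv ℝ F z + (-(a * α z + b * β z)) • fderiv ℝ T z

theorem secondForm_apply (Z : EuclideanSpace ℝ (Fin 2)) :
    secondForm a b c F T α β z Z =
      (b * α z + c * β z) • fderiv ℝ F z Z + (-(a * α z + b * β z)) • fderiv ℝ T z Z := rfl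

theorem contDiffAt_secondForm (h : IsChannelWeingartenPatch p q a b c U F T α β) (hz : z ∈ U) :
    ContDiffAt ℝ ∞ (secondForm a b c F T α β) z := by
  have hα := h.contDiffAt_α hz
  have hβ := h.contDiffAt_β hz
  have hF := h.contDiffAt_fderiv_F hz
  have hT := h.contDiffAt_fderiv_T hz
  unfold secondForm
  fun_prop

/-- With respect to a normalized lift the second form is closed. -/
theorem secondForm_closed (h : IsChannelWeingartenPatch p q a b c U F T α β)
    (hε : ∀ y ∈ U, weingartenForm a b c (α y) (β y) = ε) (hz : z ∈ U)
    (V W : EuclideanSpace ℝ (Fin 2)) :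
    fderiv ℝ (secondForm a b c F T α β) z V W = fderiv ℝ (secondForm a b c F T α β) z W V := by
  have hα := (h.differentiableAt_α hz).hasFDerivAt
  have hβ := (h.differentiableAt_β hz).hasFDerivAt
  have hF := ((h.contDiffAt_fderiv_F hz).differentiableAt (by simp)).hasFDerivAt
  have hT := ((h.contDiffAt_fderiv_T hz).differentiableAt (by simp)).hasFDerivAt
  have hd := (((hα.const_mul b).add (hβ.const_mul c)).smul hF).add
    ((((hα.const_mul a).add (hβ.const_mul b)).neg).smul hT)
  have hd' : fderiv ℝ (secondForm a b c F T α β) z = _ := hd.fderiv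
  have key : ∀ V W, fderiv ℝ (secondForm a b c F T α β) z V W =
      ((b * α z + c * β z) • fderiv ℝ (fderiv ℝ F) z V W +
        (-(a * α z + b * β z)) • fderiv ℝ (fderiv ℝ T) z V W) +
      ((b * fderiv ℝ α z V + c * fderiv ℝ β z V) • fderiv ℝ F z W +
        (-(a * fderiv ℝ α z V + b * fderiv ℝ β z V)) • fderiv ℝ T z W) := fun V W => by
    rw [hd']
    simp
    module
  obtain ⟨-, X, Y, hXY⟩ := h.exists_frame hz
  obtain ⟨hαX, hβX⟩ := h.fderiv_first hε hz hXY
  obtain ⟨k, hk1, hk2⟩ := exists_smul_eq_of_det_eq_zero (h.coeff_ne_zero z hz)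
    (r := b * fderiv ℝ α z Y + c * fderiv ℝ β z Y)
    (s := -(a * fderiv ℝ α z Y + b * fderiv ℝ β z Y))
    (by linear_combination -h.form_fderiv hε hz Y)
  have hYX : (b * fderiv ℝ α z Y + c * fderiv ℝ β z Y) • fderiv ℝ F z X +
      (-(a * fderiv ℝ α z Y + b * fderiv ℝ β z Y)) • fderiv ℝ T z X = 0 := by
    rw [hk1, hk2, mul_smul, mul_smul, ← smul_add, hXY.first, smul_zero]
  obtain ⟨v₁, v₂, rfl⟩ := hXY.span V
  obtain ⟨w₁, w₂, rfl⟩ := hXY.span W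
  rw [key, key, h.symm_F hz, h.symm_T hz]
  congr 1
  simp only [map_add, map_smul, hαX, hβX, smul_eq_mul, mul_zero, zero_add]
  have h1 : ∀ v w₁ w₂ : ℝ, (b * (v * fderiv ℝ α z Y) + c * (v * fderiv ℝ β z Y)) •
        (w₁ • fderiv ℝ F z X + w₂ • fderiv ℝ F z Y) +
      (-(a * (v * fderiv ℝ α z Y) + b * (v * fderiv ℝ β z Y))) •
        (w₁ • fderiv ℝ T z X + w₂ • fderiv ℝ T z Y) =
      (v * w₁) • ((b * fderiv ℝ α z Y + c * fderiv ℝ β z Y) • fderiv ℝ F z X +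
        (-(a * fderiv ℝ α z Y + b * fderiv ℝ β z Y)) • fderiv ℝ T z X) +
      (v * w₂) • ((b * fderiv ℝ α z Y + c * fderiv ℝ β z Y) • fderiv ℝ F z Y +
        (-(a * fderiv ℝ α z Y + b * fderiv ℝ β z Y)) • fderiv ℝ T z Y) := fun v w₁ w₂ => by
    module
  rw [h1, h1, hYX, mul_comm v₂ w₂]
  simp only [smul_zero]

/-- Locally the second form has a smooth primitive. -/
theorem exists_primitive (h : IsChannelWeingartenPatch p q a b c U F T α β)
    (hε : ∀ y ∈ U, weingartenForm a b c (α y) (β y) = ε) (hz : z ∈ U) :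
    ∃ V ⊆ U, IsOpen V ∧ z ∈ V ∧ ∃ G : EuclideanSpace ℝ (Fin 2) → Fin 6 → ℝ,
      ContDiffOn ℝ ∞ G V ∧ ∀ y ∈ V, HasFDerivAt G (secondForm a b c F T α β y) y := by
  obtain ⟨r, hr, hball⟩ := Metric.isOpen_iff.1 h.isOpen z hz
  obtain ⟨G, hG⟩ := (convex_ball z r).exists_forall_hasFDerivAt_of_fderiv_symmetric
    Metric.isOpen_ball
    (fun y hy => ((h.contDiffAt_secondForm (hball hy)).differentiableAt
      (by simp)).differentiableWithinAt)
    (fun y hy => h.secondForm_closed hε (hball hy))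
  refine ⟨Metric.ball z r, hball, Metric.isOpen_ball, Metric.mem_ball_self hr, G, ?_, hG⟩
  rw [contDiffOn_infty_iff_fderiv_of_isOpen Metric.isOpen_ball]
  refine ⟨fun y hy => (hG y hy).differentiableAt.differentiableWithinAt, fun y hy => ?_⟩
  exact (h.contDiffAt_secondForm (hball hy)).contDiffWithinAt.congr
    (fun w hw => (hG w hw).fderiv) (hG y hy).fderiv

theorem fderiv_combination (h : IsChannelWeingartenPatch p q a b c U F T α β) (hz : z ∈ U)
    (Z : EuclideanSpace ℝ (Fin 2)) :
    fderiv ℝ (fun y => α y • F y + β y • T y) z Z =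
      fderiv ℝ α z Z • F z + fderiv ℝ β z Z • T z +
        (α z • fderiv ℝ F z Z + β z • fderiv ℝ T z Z) :=
  fderiv_smul_add_smul (h.differentiableAt_α hz) (h.differentiableAt_β hz)
    (h.differentiableAt_F hz) (h.differentiableAt_T hz) Z

/-- Around each point there are coordinates `ψ = (u, v)` whose coordinate directions are the two
curvature directions. -/
theorem exists_coordinates (h : IsChannelWeingartenPatch p q a b c U F T α β)
    (hε : ∀ y ∈ U, weingartenForm a b c (α y) (β y) = ε) (hz : z ∈ U)
    {G : EuclideanSpace ℝ (Fin 2) → Fin 6 → ℝ} (hGs : ContDiffOn ℝ ∞ G U)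
    (hG : ∀ y ∈ U, HasFDerivAt G (secondForm a b c F T α β y) y) :
    ∃ ψ : OpenPartialHomeomorph (EuclideanSpace ℝ (Fin 2)) (EuclideanSpace ℝ (Fin 2)),
      z ∈ ψ.source ∧ ψ.source ⊆ U ∧ ContDiffOn ℝ ∞ ψ ψ.source ∧ ContDiffOn ℝ ∞ ψ.symm ψ.target ∧
      ∀ w ∈ ψ.target,
        (α (ψ.symm w) • fderiv ℝ F (ψ.symm w) (fderiv ℝ ψ.symm w (EuclideanSpace.single 0 1)) +
          β (ψ.symm w) •
            fderiv ℝ T (ψ.symm w) (fderiv ℝ ψ.symm w (EuclideanSpace.single 0 1)) = 0 ∧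
        fderiv ℝ α (ψ.symm w) (fderiv ℝ ψ.symm w (EuclideanSpace.single 0 1)) = 0 ∧
        fderiv ℝ β (ψ.symm w) (fderiv ℝ ψ.symm w (EuclideanSpace.single 0 1)) = 0) ∧
        secondForm a b c F T α β (ψ.symm w)
          (fderiv ℝ ψ.symm w (EuclideanSpace.single 1 1)) = 0 := by
  set s := fun y => α y • F y + β y • T y with hs
  have hsmooth : ContDiffOn ℝ ∞ s U :=
    (h.smooth_α.smul h.smooth_F).add (h.smooth_β.smul h.smooth_T)
  have hsd : ∀ y ∈ U, DifferentiableAt ℝ s y := fun y hy =>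
    (hsmooth.contDiffAt (h.isOpen.mem_nhds hy)).differentiableAt (by simp)
  have hframe : ∀ y ∈ U, ∃ X Y, IsPrincipalFrame a b c F T α β y X Y ∧ fderiv ℝ s y X = 0 ∧
      secondForm a b c F T α β y Y = 0 ∧ fderiv ℝ α y X = 0 ∧ fderiv ℝ β y X = 0 :=
      fun y hy => by
    obtain ⟨-, X, Y, hXY⟩ := h.exists_frame hy
    obtain ⟨h1, h2⟩ := h.fderiv_first hε hy hXY
    exact ⟨X, Y, hXY, by rw [h.fderiv_combination hy, h1, h2, hXY.first]; simp,
      hXY.second, h1, h2⟩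
  obtain ⟨X, Y, hXY, hsX, hY, -, -⟩ := hframe z hz
  obtain ⟨j, hj⟩ : ∃ j, secondForm a b c F T α β z X j ≠ 0 := by
    by_contra! h0
    exact hXY.second_ne (funext h0)
  obtain ⟨i, hi⟩ : ∃ i, fderiv ℝ s z Y i ≠ 0 := by
    by_contra! h0
    have h1 : fderiv ℝ s z Y = 0 := funext h0
    rw [h.fderiv_combination hz] at h1
    exact hXY.first_ne ((h.element z hz).coeff_eq_zero
      (((h.normal_F hz Y).smul _).add ((h.normal_T hz Y).smul _)) h1).2.2
  set Φ : EuclideanSpace ℝ (Fin 2) → EuclideanSpace ℝ (Fin 2) := fun y => !₂[G y j, s y i] with hΦ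
  have hΦs : ContDiffOn ℝ ∞ Φ U := by
    rw [contDiffOn_euclidean]
    intro k
    fin_cases k
    · exact (contDiffOn_pi.1 hGs) j
    · exact (contDiffOn_pi.1 hsmooth) i
  have hΦ' : ∀ y ∈ U, ∀ Z, fderiv ℝ Φ y Z =
      !₂[secondForm a b c F T α β y Z j, fderiv ℝ s y Z i] := fun y hy Z => by
    have hd : HasFDerivAt Φ (fderiv ℝ Φ y) y :=
      ((hΦs.contDiffAt (h.isOpen.mem_nhds hy)).differentiableAt (by simp)).hasFDerivAt
    have hd' := fun k => (EuclideanSpace.proj (𝕜 := ℝ) k).hasFDerivAt.comp y hd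
    have h0 := (hd' 0).unique (hasFDerivAt_pi'.1 (hG y hy) j)
    have h1 := (hd' 1).unique (hasFDerivAt_pi'.1 (hsd y hy).hasFDerivAt i)
    ext k
    fin_cases k
    · exact congrArg (fun L => L Z) h0
    · exact congrArg (fun L => L Z) h1
  obtain ⟨ψ, hzψ, hψU, hψΦ, hψs⟩ := exists_openPartialHomeomorph_of_injective_fderiv h.isOpen hΦs hz
    ((injective_iff_map_eq_zero _).2 fun Z hZ => by
      rw [hΦ' z hz] at hZ
      have h0 : secondForm a b c F T α β z Z j = 0 := congrArg (fun v => v 0) hZ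
      have h1 : fderiv ℝ s z Z i = 0 := congrArg (fun v => v 1) hZ
      obtain ⟨x, y, rfl⟩ := hXY.span Z
      simp only [map_add, map_smul, hY, hsX, smul_zero, add_zero, zero_add, Pi.smul_apply,
        smul_eq_mul, mul_eq_zero, hj, hi, or_false] at h0 h1
      simp [h0, h1])
  refine ⟨ψ, hzψ, hψU, hψΦ ▸ hΦs.mono hψU, hψs, fun w hw => ?_⟩
  have hyU : ψ.symm w ∈ U := hψU (ψ.map_target hw)
  set k := ψ.symm w with hk
  set D := fderiv ℝ ψ.symm w with hD
  have hkey : ∀ e, !₂[secondForm a b c F T α β k (D e) j, fderiv ℝ s k (D e) i] = e := fun e => by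
    have h1 : HasFDerivAt ψ.symm D w :=
      ((hψs.contDiffAt (ψ.open_target.mem_nhds hw)).differentiableAt (by simp)).hasFDerivAt
    have h2 : HasFDerivAt Φ (fderiv ℝ Φ k) k :=
      ((hΦs.contDiffAt (h.isOpen.mem_nhds hyU)).differentiableAt (by simp)).hasFDerivAt
    have h3 : Φ ∘ ψ.symm =ᶠ[𝓝 w] id := by
      filter_upwards [ψ.open_target.mem_nhds hw] with v hv
      rw [← hψΦ]; exact ψ.right_inv hv
    have h4 := (h2.comp w h1).unique ((hasFDerivAt_id w).congr_of_eventuallyEq h3)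
    have h5 := congrArg (fun L => L e) h4
    rw [← hΦ' k hyU]
    exact h5
  have hG0 := congrArg (fun v => v 0) (hkey (EuclideanSpace.single 0 1))
  have hs0 := congrArg (fun v => v 1) (hkey (EuclideanSpace.single 0 1))
  have hG1 := congrArg (fun v => v 0) (hkey (EuclideanSpace.single 1 1))
  have hs1 := congrArg (fun v => v 1) (hkey (EuclideanSpace.single 1 1))
  obtain ⟨X, Y, hXY, hsX, hY, hαX, hβX⟩ := hframe k hyU
  obtain ⟨x₀, y₀, h0⟩ := hXY.span (D (EuclideanSpace.single 0 1))
  obtain ⟨x₁, y₁, h1⟩ := hXY.span (D (EuclideanSpace.single 1 1))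
  simp [h0, h1, hsX, hY] at hG0 hs0 hG1 hs1
  have hy₀ : y₀ = 0 := hs0.resolve_right fun h' => by simp [h'] at hs1
  have hx₁ : x₁ = 0 := hG1.resolve_right fun h' => by simp [h'] at hG0
  rw [h0, h1, hy₀, hx₁]
  simp only [zero_smul, add_zero, zero_add, map_smul, hαX, hβX, smul_zero, hY, and_self, and_true]
  rw [smul_comm (α k), smul_comm (β k), ← smul_add, hXY.first, smul_zero]

/-- Let `D` be the determinant of the coefficients of the channel spheres and of a sphere
congruence `⟨m₀ F + m₁ T⟩` with constant coefficients. If `D` has no zero, then `D⁻¹ (m₀ F + m₁ T)`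
has vanishing mixed second derivative in the coordinates `ψ`. -/
theorem mixed_fderiv_eq_zero (h : IsChannelWeingartenPatch p q a b c U F T α β) (hε0 : ε ≠ 0)
    (hε : ∀ y ∈ U, weingartenForm a b c (α y) (β y) = ε)
    {G : EuclideanSpace ℝ (Fin 2) → Fin 6 → ℝ} (hGs : ContDiffOn ℝ ∞ G U)
    (hG : ∀ y ∈ U, HasFDerivAt G (secondForm a b c F T α β y) y)
    {W : Set (EuclideanSpace ℝ (Fin 2))} (hW : IsOpen W)
    {κ : EuclideanSpace ℝ (Fin 2) → EuclideanSpace ℝ (Fin 2)} (hκ : ContDiffOn ℝ ∞ κ W)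
    (hκU : Set.MapsTo κ W U) {e₀ e₁ : EuclideanSpace ℝ (Fin 2)}
    (he₀ : ∀ w ∈ W, α (κ w) • fderiv ℝ F (κ w) (fderiv ℝ κ w e₀) +
        β (κ w) • fderiv ℝ T (κ w) (fderiv ℝ κ w e₀) = 0 ∧
      fderiv ℝ α (κ w) (fderiv ℝ κ w e₀) = 0 ∧ fderiv ℝ β (κ w) (fderiv ℝ κ w e₀) = 0)
    (he₁ : ∀ w ∈ W, secondForm a b c F T α β (κ w) (fderiv ℝ κ w e₁) = 0)
    {m₀ m₁ : ℝ} (hD : ∀ y ∈ U, α y * m₁ - β y * m₀ ≠ 0) {w : EuclideanSpace ℝ (Fin 2)}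
    (hw : w ∈ W) :
    fderiv ℝ (fun v => fderiv ℝ (fun w =>
      (α (κ w) * m₁ - β (κ w) * m₀)⁻¹ • (m₀ • F (κ w) + m₁ • T (κ w))) v e₀) w e₁ = 0 := by
  have hκd : ∀ v ∈ W, HasFDerivAt κ (fderiv ℝ κ v) v := fun v hv =>
    ((hκ.contDiffAt (hW.mem_nhds hv)).differentiableAt (by simp)).hasFDerivAt
  have hGκ : ∀ v ∈ W, ∀ e, fderiv ℝ (fun w => G (κ w)) v e =
      secondForm a b c F T α β (κ v) (fderiv ℝ κ v e) := fun v hv e => by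
    have hd : fderiv ℝ (fun w => G (κ w)) v = _ := ((hG _ (hκU hv)).comp v (hκd v hv)).fderiv
    rw [hd]; rfl
  have h₀ : ∀ v ∈ W, fderiv ℝ (fun w =>
      (α (κ w) * m₁ - β (κ w) * m₀)⁻¹ • (m₀ • F (κ w) + m₁ • T (κ w))) v e₀ =
        (-ε⁻¹) • fderiv ℝ (fun w => G (κ w)) v e₀ := fun v hv => by
    have hy := hκU hv
    obtain ⟨h1, h2, h3⟩ := he₀ v hv
    have hα := (h.differentiableAt_α hy).hasFDerivAt
    have hβ := (h.differentiableAt_β hy).hasFDerivAt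
    have hF := (h.differentiableAt_F hy).hasFDerivAt
    have hT := (h.differentiableAt_T hy).hasFDerivAt
    have hd : HasFDerivAt (fun y => (α y * m₁ - β y * m₀)⁻¹) _ (κ v) :=
      (hasDerivAt_inv (hD _ hy)).comp_hasFDerivAt (κ v)
        ((hα.mul_const m₁).sub (hβ.mul_const m₀))
    have hd' := (hd.smul ((hF.const_smul m₀).add (hT.const_smul m₁))).comp v (hκd v hv)
    have hd'' : fderiv ℝ (fun w =>
      (α (κ w) * m₁ - β (κ w) * m₀)⁻¹ • (m₀ • F (κ w) + m₁ • T (κ w))) v = _ := hd'.fderiv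
    rw [hd'', hGκ v hv]
    have hQ := hε _ hy
    have hDy := hD _ hy
    simp [h2, h3]
    rw [secondForm_apply, ← sub_eq_zero]
    have key : ∀ f t : Fin 6 → ℝ, (α (κ v) * m₁ - β (κ v) * m₀)⁻¹ • m₀ • f +
        (α (κ v) * m₁ - β (κ v) * m₀)⁻¹ • m₁ • t -
          -(ε⁻¹ • ((b * α (κ v) + c * β (κ v)) • f + (-(a * α (κ v) + b * β (κ v))) • t)) =
        ((α (κ v) * m₁ - β (κ v) * m₀)⁻¹ * ε⁻¹ * (m₁ * (b * α (κ v) + c * β (κ v)) +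
          m₀ * (a * α (κ v) + b * β (κ v)))) • (α (κ v) • f + β (κ v) • t) := fun f t => by
      rw [weingartenForm] at hQ
      match_scalars
      · field_simp
        rw [← hQ]; ring
      · field_simp
        rw [← hQ]; ring
    rw [key, h1, smul_zero]
  have hev : (fun v => fderiv ℝ (fun w =>
      (α (κ w) * m₁ - β (κ w) * m₀)⁻¹ • (m₀ • F (κ w) + m₁ • T (κ w))) v e₀) =ᶠ[𝓝 w]
        fun v => (-ε⁻¹) • fderiv ℝ (fun w => G (κ w)) v e₀ := by
    filter_upwards [hW.mem_nhds hw] with v hv using h₀ v hv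
  have hGκs : ContDiffAt ℝ ∞ (fun w => G (κ w)) w :=
    (hGs.contDiffAt (h.isOpen.mem_nhds (hκU hw))).comp w (hκ.contDiffAt (hW.mem_nhds hw))
  have hdd : DifferentiableAt ℝ (fderiv ℝ (fun w => G (κ w))) w :=
    (hGκs.fderiv_right (m := ∞) (by simp)).differentiableAt (by simp)
  have happ : ∀ e e', fderiv ℝ (fun v => fderiv ℝ (fun w => G (κ w)) v e) w e' =
      fderiv ℝ (fderiv ℝ (fun w => G (κ w))) w e' e := fun e e' => by
    rw [fderiv_clm_apply hdd (differentiableAt_const e)]; simp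
  have h₁ : (fun v => fderiv ℝ (fun w => G (κ w)) v e₁) =ᶠ[𝓝 w] fun _ => 0 := by
    filter_upwards [hW.mem_nhds hw] with v hv
    rw [hGκ v hv, he₁ v hv]
  rw [hev.fderiv_eq, fderiv_fun_const_smul (hdd.clm_apply (differentiableAt_const e₀)),
    smul_apply, happ,
    hGκs.isSymmSndFDerivAt (by simp; exact ENat.LEInfty.out), ← happ, h₁.fderiv_eq]
  simp

/-- A sphere congruence with constant coefficients which either coincides with the channel spheres
everywhere or nowhere has a lift with vanishing mixed second derivative in curvature line
coordinates. -/
theorem exists_moutard (h : IsChannelWeingartenPatch p q a b c U F T α β) (hz : z ∈ U) {m₀ m₁ : ℝ}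
    (hD : (∀ y ∈ U, α y * m₁ - β y * m₀ = 0) ∨ ∀ y ∈ U, α y * m₁ - β y * m₀ ≠ 0) :
    ∃ ψ : OpenPartialHomeomorph (EuclideanSpace ℝ (Fin 2)) (EuclideanSpace ℝ (Fin 2)),
      z ∈ ψ.source ∧ ψ.source ⊆ U ∧ ContDiffOn ℝ ∞ ψ ψ.source ∧ ContDiffOn ℝ ∞ ψ.symm ψ.target ∧
      (∀ w ∈ ψ.target, ∀ i : Fin 2, ∃ r s : ℝ, (r, s) ≠ 0 ∧
        fderiv ℝ (fun v => r • F (ψ.symm v) + s • T (ψ.symm v)) w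
          (EuclideanSpace.single i 1) = 0) ∧
      ∃ g : EuclideanSpace ℝ (Fin 2) → ℝ, ContDiffOn ℝ ∞ g ψ.source ∧ (∀ y ∈ ψ.source, g y ≠ 0) ∧
        ∀ w ∈ ψ.target, fderiv ℝ (fun v => fderiv ℝ
          (fun w => g (ψ.symm w) • (m₀ • F (ψ.symm w) + m₁ • T (ψ.symm w))) v
            (EuclideanSpace.single 0 1)) w (EuclideanSpace.single 1 1) = 0 := by
  obtain ⟨ε, hε0, U₁, hU₁, hz₁, ρ, hρ0, h₁, hε⟩ := h.exists_normalized hz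
  obtain ⟨U₂, hU₂, hU₂o, hz₂, G, hGs, hG⟩ := h₁.exists_primitive hε hz₁
  have h₂ := h₁.mono hU₂o hU₂
  have hε₂ := fun y hy => hε y (hU₂ hy)
  obtain ⟨ψ, hzψ, hψU, hψ, hψs, hψd⟩ := h₂.exists_coordinates hε₂ hz₂ hGs hG
  have hmaps : Set.MapsTo ψ.symm ψ.target U₂ := fun w hw => hψU (ψ.map_target hw)
  have hcomb : ∀ w ∈ ψ.target, ∀ (r s : ℝ) (e : EuclideanSpace ℝ (Fin 2)),
      fderiv ℝ (fun v => r • F (ψ.symm v) + s • T (ψ.symm v)) w e =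
        r • fderiv ℝ F (ψ.symm w) (fderiv ℝ ψ.symm w e) +
          s • fderiv ℝ T (ψ.symm w) (fderiv ℝ ψ.symm w e) := fun w hw r s e => by
    have hd := ((hψs.contDiffAt (ψ.open_target.mem_nhds hw)).differentiableAt
      (by simp)).hasFDerivAt
    have hF := (h₂.differentiableAt_F (hmaps hw)).hasFDerivAt.comp w hd
    have hT := (h₂.differentiableAt_T (hmaps hw)).hasFDerivAt.comp w hd
    have : fderiv ℝ (fun v => r • F (ψ.symm v) + s • T (ψ.symm v)) w = _ :=
      ((hF.const_smul r).add (hT.const_smul s)).fderiv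
    rw [this]; rfl
  refine ⟨ψ, hzψ, fun y hy => hU₁ (hU₂ (hψU hy)), hψ, hψs, fun w hw i => ?_, ?_⟩
  · obtain ⟨⟨e1, -, -⟩, e2⟩ := hψd w hw
    fin_cases i
    · exact ⟨_, _, h₂.coeff_ne_zero _ (hmaps hw), (hcomb w hw _ _ _).trans e1⟩
    · refine ⟨_, _, fun h0 => ?_, (hcomb w hw _ _ _).trans e2⟩
      obtain ⟨e3, e4⟩ := Prod.ext_iff.1 h0
      simp only [Prod.fst_zero, Prod.snd_zero] at e3 e4
      have hQ := hε₂ _ (hmaps hw)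
      apply hε0
      rw [← hQ, weingartenForm]
      linear_combination ρ (ψ.symm w) * β (ψ.symm w) * e3 - ρ (ψ.symm w) * α (ψ.symm w) * e4
  · rcases hD with hD | hD
    · refine ⟨fun _ => 1, contDiffOn_const, fun _ _ => one_ne_zero, fun w hw => ?_⟩
      have hev : (fun v => fderiv ℝ
          (fun w => (1 : ℝ) • (m₀ • F (ψ.symm w) + m₁ • T (ψ.symm w))) v
            (EuclideanSpace.single 0 1)) =ᶠ[𝓝 w] fun _ => 0 := by
        filter_upwards [ψ.open_target.mem_nhds hw] with v hv
        simp only [one_smul]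
        rw [hcomb v hv]
        have hy := hmaps hv
        have hDy := hD _ (hU₁ (hU₂ hy))
        obtain ⟨k, hk₀, hk₁⟩ := exists_smul_eq_of_det_eq_zero (h₂.coeff_ne_zero _ hy)
          (r := m₀) (s := m₁) (by linear_combination ρ (ψ.symm v) * hDy)
        rw [hk₀, hk₁, mul_smul k, mul_smul k, ← smul_add, (hψd v hv).1.1, smul_zero]
      rw [hev.fderiv_eq]; simp
    · have hD' : ∀ y ∈ U₂, ρ y * α y * m₁ - ρ y * β y * m₀ ≠ 0 := fun y hy => by
        have : ρ y * α y * m₁ - ρ y * β y * m₀ = ρ y * (α y * m₁ - β y * m₀) := by ring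
        rw [this]
        exact mul_ne_zero (hρ0 y (hU₂ hy)) (hD y (hU₁ (hU₂ hy)))
      refine ⟨fun y => (ρ y * α y * m₁ - ρ y * β y * m₀)⁻¹, ?_,
        fun y hy => inv_ne_zero (hD' y (hψU hy)), fun w hw =>
          h₂.mixed_fderiv_eq_zero hε0 hε₂ hGs hG ψ.open_target hψs hmaps
            (fun v hv => (hψd v hv).1) (fun v hv => (hψd v hv).2) hD' hw⟩
      exact (((h₂.smooth_α.mul contDiffOn_const).sub (h₂.smooth_β.mul contDiffOn_const)).inv
        hD').mono hψU

end IsChannelWeingartenPatch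

section Transfer

variable {M : Type*} [TopologicalSpace M] [ChartedSpace (EuclideanSpace ℝ (Fin 2)) M]

local notation "E₂" => EuclideanSpace ℝ (Fin 2)

theorem mem_legendreLift_eq {p q : Fin 6 → ℝ} {f t : M → Fin 6 → ℝ}
    (hf : IsSpaceFormSurface p q f t) {y : M} {σ : Fin 6 → ℝ} (hσ : σ ∈ legendreLift f t y) :
    σ = (-lieInner σ q) • f y + (-lieInner σ p) • t y := by
  obtain ⟨r, s, rfl⟩ := Submodule.mem_span_pair.1 hσ
  have h1 := hf.mem_spaceForm y
  have h2 := hf.mem_planes y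
  simp [lieInner_add_left, lieInner_smul_left, h1.2.1, h1.2.2, h2.2.1, h2.2.2]

theorem contMDiffOn_lieInner_left {V : Set M} {s : M → Fin 6 → ℝ}
    (hs : ContMDiffOn (𝓡 2) 𝓘(ℝ, Fin 6 → ℝ) ∞ s V) (w : Fin 6 → ℝ) :
    ContMDiffOn (𝓡 2) 𝓘(ℝ, ℝ) ∞ (fun y => -lieInner (s y) w) V :=
  (-(lieForm.flip w)).contMDiff.comp_contMDiffOn hs

theorem isSection_combination {p q : Fin 6 → ℝ} {f t : M → Fin 6 → ℝ}
    (hf : IsSpaceFormSurface p q f t) (r s : ℝ) :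
    IsSection (legendreLift f t) (fun y => r • f y + s • t y) :=
  have hsmul : ∀ (k : ℝ) {g : M → Fin 6 → ℝ}, ContMDiff (𝓡 2) 𝓘(ℝ, Fin 6 → ℝ) ∞ g →
      ContMDiff (𝓡 2) 𝓘(ℝ, Fin 6 → ℝ) ∞ fun y => k • g y := fun k _ hg =>
    (k • ContinuousLinearMap.id ℝ (Fin 6 → ℝ)).contMDiff.comp hg
  ⟨(hsmul r hf.smooth_f).add (hsmul s hf.smooth_t),
    fun _ => Submodule.mem_span_pair.2 ⟨r, s, rfl⟩⟩

theorem isContactElement_of_surface {p q : Fin 6 → ℝ} {f t : M → Fin 6 → ℝ}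
    (hf : IsSpaceFormSurface p q f t) (y : M) : IsContactElement p q (f y) (t y) where
  point := hf.mem_spaceForm y
  plane := hf.mem_planes y
  incident := by
    have h := hf.legendre.isotropic _ _ (isSection_combination hf 1 0)
      (isSection_combination hf 0 1) y
    simpa using h

theorem combination_ne_zero {p q : Fin 6 → ℝ} {f t : M → Fin 6 → ℝ}
    (hf : IsSpaceFormSurface p q f t) (y : M) {r s : ℝ} (h : (r, s) ≠ 0) :
    r • f y + s • t y ≠ 0 := fun h0 => h (by
  obtain ⟨h1, h2, -⟩ := (isContactElement_of_surface hf y).coeff_eq_zero (z := 0)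
    (by constructor <;> exact lieInner_zero_left _) (by rw [h0, add_zero])
  rw [h1, h2]; rfl)

variable [IsManifold (𝓡 2) ∞ M]

theorem contDiffOn_comp_chart_symm {G : Type*} [NormedAddCommGroup G] [NormedSpace ℝ G] (x : M)
    {V : Set M} {s : M → G} (hs : ContMDiffOn (𝓡 2) 𝓘(ℝ, G) ∞ s V) :
    ContDiffOn ℝ ∞ (fun z => s ((chartAt E₂ x).symm z))
      ((chartAt E₂ x).target ∩ (chartAt E₂ x).symm ⁻¹' V) := by
  rw [← contMDiffOn_iff_contDiffOn]
  exact hs.comp (contMDiffOn_chart_symm.mono Set.inter_subset_left) fun z hz => hz.2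

/-- The derivative of the chart around `x`. -/
def chartDeriv (x y : M) : TangentSpace (𝓡 2) y →L[ℝ] E₂ :=
  mfderiv (𝓡 2) (𝓡 2) (chartAt E₂ x) y

theorem dAt_eq_fderiv (x : M) {V : Set M} (hV : IsOpen V) {s : M → Fin 6 → ℝ}
    (hs : ContMDiffOn (𝓡 2) 𝓘(ℝ, Fin 6 → ℝ) ∞ s V) {y : M} (hyV : y ∈ V)
    (hy : y ∈ (chartAt E₂ x).source) (X : TangentSpace (𝓡 2) y) :
    dAt s y X = fderiv ℝ (fun z => s ((chartAt E₂ x).symm z)) (chartAt E₂ x y)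
      (chartDeriv x y X) := by
  set ch := chartAt E₂ x with hch
  have hmem : ch y ∈ ch.target ∩ ch.symm ⁻¹' V :=
    ⟨ch.map_source hy, by rw [Set.mem_preimage, ch.left_inv hy]; exact hyV⟩
  have hd : DifferentiableAt ℝ (fun z => s (ch.symm z)) (ch y) :=
    ((contDiffOn_comp_chart_symm x hs).contDiffAt
      ((ch.isOpen_inter_preimage_symm hV).mem_nhds hmem)).differentiableAt (by simp)
  have hc : MDifferentiableAt (𝓡 2) (𝓡 2) ch y :=
    (contMDiffOn_chart (n := ∞) (x := x)).mdifferentiableOn (by simp) |>.mdifferentiableAt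
      (ch.open_source.mem_nhds hy)
  have hev : s =ᶠ[𝓝 y] (fun z => s (ch.symm z)) ∘ ch := by
    filter_upwards [ch.open_source.mem_nhds hy] with w hw
    simp [ch.left_inv hw]
  rw [dAt, hev.mfderiv_eq, mfderiv_comp y hd.mdifferentiableAt hc, mfderiv_eq_fderiv]
  rfl

theorem chartDeriv_bijective (x : M) {y : M} (hy : y ∈ (chartAt E₂ x).source) :
    Function.Bijective (chartDeriv x y) :=
  have : IsManifold (𝓡 2) 1 M := .of_le (n := ∞) (by simp)
  (mdifferentiable_chart x).mfderiv_bijective hy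

theorem fderiv_combination_const {p q : Fin 6 → ℝ} {f t : M → Fin 6 → ℝ}
    (hf : IsSpaceFormSurface p q f t) (x : M) {z : E₂} (hz : z ∈ (chartAt E₂ x).target) (r s : ℝ)
    (Z : E₂) :
    fderiv ℝ (fun z => r • f ((chartAt E₂ x).symm z) + s • t ((chartAt E₂ x).symm z)) z Z =
      r • fderiv ℝ (fun z => f ((chartAt E₂ x).symm z)) z Z +
        s • fderiv ℝ (fun z => t ((chartAt E₂ x).symm z)) z Z := by
  have hd : ∀ {s : M → Fin 6 → ℝ}, ContMDiff (𝓡 2) 𝓘(ℝ, Fin 6 → ℝ) ∞ s →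
      DifferentiableAt ℝ (fun z => s ((chartAt E₂ x).symm z)) z := fun hs =>
    ((contDiffOn_comp_chart_symm x (hs.contMDiffOn (s := Set.univ))).contDiffAt
      (by simpa using (chartAt E₂ x).open_target.mem_nhds hz)).differentiableAt (by simp)
  have := fderiv_smul_add_smul (differentiableAt_const r) (differentiableAt_const s)
    (hd hf.smooth_f) (hd hf.smooth_t) Z
  simpa using this

/-- A vanishing combination of the derivatives of `f` and `t` yields a curvature sphere. -/
theorem isCurvatureSphereAt_of_fderiv {p q : Fin 6 → ℝ} {f t : M → Fin 6 → ℝ}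
    (hf : IsSpaceFormSurface p q f t) (x : M) {y : M} (hy : y ∈ (chartAt E₂ x).source) {r s : ℝ}
    (hrs : (r, s) ≠ 0) {X : TangentSpace (𝓡 2) y} (hX : X ≠ 0)
    (h : r • fderiv ℝ (fun z => f ((chartAt E₂ x).symm z)) (chartAt E₂ x y)
        (chartDeriv x y X) +
      s • fderiv ℝ (fun z => t ((chartAt E₂ x).symm z)) (chartAt E₂ x y)
        (chartDeriv x y X) = 0) :
    IsCurvatureSphereAt (legendreLift f t) y (r • f y + s • t y) X := by
  refine ⟨combination_ne_zero hf y hrs, hX, _, isSection_combination hf r s, rfl, ?_⟩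
  rw [dAt_eq_fderiv x isOpen_univ (isSection_combination hf r s).1.contMDiffOn (Set.mem_univ y) hy,
    fderiv_combination_const hf x ((chartAt E₂ x).map_source hy), h]
  exact Submodule.zero_mem _

/-- The Legendre lift of a linear Weingarten surface, read in a chart. -/
theorem isWeingartenPatch {p q : Fin 6 → ℝ} {f t : M → Fin 6 → ℝ} {a b c : ℝ}
    (hf : IsSpaceFormSurface p q f t) (humb : IsUmbilicFree (legendreLift f t))
    (hdet : a * c - b ^ 2 ≠ 0)
    (hW : ∀ (x : M) (σ₁ σ₂ : Fin 6 → ℝ) (X₁ X₂ : TangentSpace (𝓡 2) x),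
      IsCurvatureSphereAt (legendreLift f t) x σ₁ X₁ →
      IsCurvatureSphereAt (legendreLift f t) x σ₂ X₂ →
      LinearIndependent ℝ ![σ₁, σ₂] → WeingartenRelation p q a b c σ₁ σ₂) (x : M) :
    IsWeingartenPatch p q a b c (chartAt E₂ x).target (fun z => f ((chartAt E₂ x).symm z))
      (fun z => t ((chartAt E₂ x).symm z)) := by
  set ch := chartAt E₂ x with hch
  have hsm : ∀ {s : M → Fin 6 → ℝ}, ContMDiff (𝓡 2) 𝓘(ℝ, Fin 6 → ℝ) ∞ s →
      ContDiffOn ℝ ∞ (fun z => s (ch.symm z)) ch.target := fun hs => by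
    simpa using contDiffOn_comp_chart_symm x (hs.contMDiffOn (s := Set.univ))
  have hdiff : ∀ {G : Type} [NormedAddCommGroup G] [NormedSpace ℝ G] {s : E₂ → G},
      ContDiffOn ℝ ∞ s ch.target → ∀ z ∈ ch.target, DifferentiableAt ℝ s z := fun hs z hz =>
    (hs.contDiffAt (ch.open_target.mem_nhds hz)).differentiableAt (by simp)
  refine ⟨ch.open_target, hsm hf.smooth_f, hsm hf.smooth_t,
    fun z _ => isContactElement_of_surface hf _, fun z hz X => ?_, fun z hz X hfX htX => ?_,
    fun z hz r s hrs => ?_, hdet, fun z hz r₁ s₁ r₂ s₂ X₁ X₂ hX₁ hX₂ h₁ h₂ hne => ?_⟩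
  all_goals obtain ⟨y, hy, rfl⟩ : ∃ y ∈ ch.source, ch y = z :=
    ⟨ch.symm z, ch.map_target hz, ch.right_inv hz⟩
  · obtain ⟨X, rfl⟩ := (chartDeriv_bijective x hy).2 X
    have h := hf.legendre.contact _ _ (isSection_combination hf 1 0)
      (isSection_combination hf 0 1) y X
    rw [dAt_eq_fderiv x isOpen_univ (isSection_combination hf 1 0).1.contMDiffOn
      (Set.mem_univ y) hy] at h
    simpa [ch.left_inv hy] using h
  · obtain ⟨X, rfl⟩ := (chartDeriv_bijective x hy).2 X
    have hX : X = 0 := by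
      refine hf.legendre.immersion y X fun s hs => ?_
      rw [dAt_eq_fderiv x isOpen_univ hs.1.contMDiffOn (Set.mem_univ y) hy]
      have hA := fun w => contDiffOn_comp_chart_symm x
        (contMDiffOn_lieInner_left (hs.1.contMDiffOn (s := Set.univ)) w)
      simp only [Set.preimage_univ, Set.inter_univ] at hA
      have heq : (fun z => s (ch.symm z)) = fun z =>
          (-lieInner (s (ch.symm z)) q) • f (ch.symm z) +
            (-lieInner (s (ch.symm z)) p) • t (ch.symm z) :=
        funext fun z => mem_legendreLift_eq hf (hs.2 _)
      rw [heq, fderiv_smul_add_smul (hdiff (hA q) _ hz) (hdiff (hA p) _ hz)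
        (hdiff (hsm hf.smooth_f) _ hz) (hdiff (hsm hf.smooth_t) _ hz), hfX, htX, smul_zero,
        smul_zero, add_zero, add_zero, ch.left_inv hy]
      exact Submodule.mem_span_pair.2 ⟨_, _, rfl⟩
    rw [hX, map_zero]
  · by_contra! h0
    exact humb y ⟨_, fun X hX => isCurvatureSphereAt_of_fderiv hf x hy hrs hX (h0 _)⟩
  · obtain ⟨X₁, rfl⟩ := (chartDeriv_bijective x hy).2 X₁
    obtain ⟨X₂, rfl⟩ := (chartDeriv_bijective x hy).2 X₂
    have hne₁ : (r₁, s₁) ≠ 0 := fun h0 => hne (by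
      obtain ⟨e1, e2⟩ := Prod.ext_iff.1 h0
      simp only [Prod.fst_zero, Prod.snd_zero] at e1 e2
      rw [e1, e2]; ring)
    have hne₂ : (r₂, s₂) ≠ 0 := fun h0 => hne (by
      obtain ⟨e1, e2⟩ := Prod.ext_iff.1 h0
      simp only [Prod.fst_zero, Prod.snd_zero] at e1 e2
      rw [e1, e2]; ring)
    have hrel := hW y _ _ X₁ X₂
      (isCurvatureSphereAt_of_fderiv hf x hy hne₁ (fun h0 => hX₁ (by rw [h0, map_zero])) h₁)
      (isCurvatureSphereAt_of_fderiv hf x hy hne₂ (fun h0 => hX₂ (by rw [h0, map_zero])) h₂)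
      (by
        rw [LinearIndependent.pair_iff]
        intro u v huv
        have h0 : (u * r₁ + v * r₂) • f y + (u * s₁ + v * s₂) • t y = 0 := by
          rw [← huv]; module
        have h1 : (u * r₁ + v * r₂, u * s₁ + v * s₂) = (0 : ℝ × ℝ) :=
          by_contra fun h => combination_ne_zero hf y h h0
        obtain ⟨e1, e2⟩ := Prod.ext_iff.1 h1
        simp only [Prod.fst_zero, Prod.snd_zero] at e1 e2
        exact ⟨(mul_eq_zero.1 (show u * (r₁ * s₂ - s₁ * r₂) = 0 by
            linear_combination s₂ * e1 - r₂ * e2)).resolve_right hne,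
          (mul_eq_zero.1 (show v * (r₁ * s₂ - s₁ * r₂) = 0 by
            linear_combination r₁ * e2 - s₁ * e1)).resolve_right hne⟩)
    have h1 := hf.mem_spaceForm y
    have h2 := hf.mem_planes y
    simp only [WeingartenRelation, lieInner_add_left, lieInner_smul_left, h1.2.1, h1.2.2, h2.2.1,
      h2.2.2] at hrel
    unfold CoeffRelation
    linear_combination hrel

/-- A linear Weingarten channel surface, read in a chart. -/
theorem isChannelWeingartenPatch {p q : Fin 6 → ℝ} {f t : M → Fin 6 → ℝ} {a b c : ℝ}
    (hf : IsSpaceFormSurface p q f t) {x : M}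
    (hpatch : IsWeingartenPatch p q a b c (chartAt E₂ x).target
      (fun z => f ((chartAt E₂ x).symm z)) (fun z => t ((chartAt E₂ x).symm z)))
    {S : M → Submodule ℝ (Fin 6 → ℝ)} (hS : IsChannelFamily (legendreLift f t) S)
    {V : Set M} (hV : IsOpen V) {σ : M → Fin 6 → ℝ} (hσ : IsLift S V σ) :
    IsChannelWeingartenPatch p q a b c ((chartAt E₂ x).target ∩ (chartAt E₂ x).symm ⁻¹' V)
      (fun z => f ((chartAt E₂ x).symm z)) (fun z => t ((chartAt E₂ x).symm z))
      (fun z => -lieInner (σ ((chartAt E₂ x).symm z)) q)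
      (fun z => -lieInner (σ ((chartAt E₂ x).symm z)) p) := by
  set ch := chartAt E₂ x with hch
  have hopen : IsOpen (ch.target ∩ ch.symm ⁻¹' V) := ch.isOpen_inter_preimage_symm hV
  have hα : ContDiffOn ℝ ∞ (fun z => -lieInner (σ (ch.symm z)) q) (ch.target ∩ ch.symm ⁻¹' V) :=
    contDiffOn_comp_chart_symm x (contMDiffOn_lieInner_left hσ.1 q)
  have hβ : ContDiffOn ℝ ∞ (fun z => -lieInner (σ (ch.symm z)) p) (ch.target ∩ ch.symm ⁻¹' V) :=
    contDiffOn_comp_chart_symm x (contMDiffOn_lieInner_left hσ.1 p)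
  have hmem : ∀ y ∈ V, σ y ∈ legendreLift f t y := fun y hy => hS.envelops y (by
    rw [(hσ.2 y hy).2.2]; exact Submodule.mem_span_singleton_self _)
  have hw := hpatch.mono hopen Set.inter_subset_left
  refine { hw with
    smooth_α := hα
    smooth_β := hβ
    coeff_ne_zero := fun z hz h0 => ?_
    channel := fun z hz => ?_ }
  · obtain ⟨e1, e2⟩ := Prod.ext_iff.1 h0
    simp only [Prod.fst_zero, Prod.snd_zero] at e1 e2
    apply (hσ.2 _ hz.2).1
    rw [mem_legendreLift_eq hf (hmem _ hz.2), e1, e2]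
    simp
  · obtain ⟨y, hy, rfl⟩ : ∃ y ∈ ch.source, ch y = z :=
      ⟨ch.symm z, ch.map_target hz.1, ch.right_inv hz.1⟩
    have hyV : y ∈ V := by have := hz.2; rwa [Set.mem_preimage, ch.left_inv hy] at this
    obtain ⟨X, hX0, hX⟩ := hS.oneParameter y V σ hV hyV hσ
    refine ⟨chartDeriv x y X, fun h0 =>
      hX0 ((chartDeriv_bijective x hy).1 (by rw [h0, map_zero])), ?_⟩
    set Z : E₂ := chartDeriv x y X with hZ
    rw [(hσ.2 y hyV).2.2, Submodule.mem_span_singleton] at hX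
    obtain ⟨k, hk⟩ := hX
    have hev : (fun z => σ (ch.symm z)) =ᶠ[𝓝 (ch y)] fun z =>
        (-lieInner (σ (ch.symm z)) q) • f (ch.symm z) +
          (-lieInner (σ (ch.symm z)) p) • t (ch.symm z) := by
      filter_upwards [hopen.mem_nhds hz] with v hv
      exact mem_legendreLift_eq hf (hmem _ hv.2)
    rw [dAt_eq_fderiv x hV hσ.1 hyV hy, hev.fderiv_eq, fderiv_smul_add_smul
      ((hα.contDiffAt (hopen.mem_nhds hz)).differentiableAt (by simp))
      ((hβ.contDiffAt (hopen.mem_nhds hz)).differentiableAt (by simp))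
      (hw.differentiableAt_F hz) (hw.differentiableAt_T hz)] at hk
    have hσy : σ y = (-lieInner (σ (ch.symm (ch y))) q) • f (ch.symm (ch y)) +
        (-lieInner (σ (ch.symm (ch y))) p) • t (ch.symm (ch y)) := by
      rw [ch.left_inv hy]; exact mem_legendreLift_eq hf (hmem y hyV)
    rw [hσy] at hk
    have hN := ((hw.normal_F hz Z).smul (-lieInner (σ (ch.symm (ch y))) q)).add
      ((hw.normal_T hz Z).smul (-lieInner (σ (ch.symm (ch y))) p))
    have h0 : (fderiv ℝ (fun z => -lieInner (σ (ch.symm z)) q) (ch y) Z -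
          k * (-lieInner (σ (ch.symm (ch y))) q)) • f (ch.symm (ch y)) +
        (fderiv ℝ (fun z => -lieInner (σ (ch.symm z)) p) (ch y) Z -
          k * (-lieInner (σ (ch.symm (ch y))) p)) • t (ch.symm (ch y)) +
        ((-lieInner (σ (ch.symm (ch y))) q) • fderiv ℝ (fun z => f (ch.symm z)) (ch y) Z +
          (-lieInner (σ (ch.symm (ch y))) p) • fderiv ℝ (fun z => t (ch.symm z)) (ch y) Z) = 0 := by
      rw [← sub_eq_zero.2 hk.symm]
      module
    obtain ⟨e1, e2, e3⟩ := (isContactElement_of_surface hf _).coeff_eq_zero hN h0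
    exact ⟨e3, k, sub_eq_zero.1 e1, sub_eq_zero.1 e2⟩

end Transfer

section Main

variable {M : Type*} [TopologicalSpace M]

theorem coordDerivUV_congr {φ : Coord M} {s : M → Fin 6 → ℝ}
    {h : EuclideanSpace ℝ (Fin 2) → Fin 6 → ℝ} {W : Set (EuclideanSpace ℝ (Fin 2))} (hW : IsOpen W)
    (hs : ∀ w ∈ W, s (φ.symm w) = h w) {z : EuclideanSpace ℝ (Fin 2)} (hz : z ∈ W) :
    coordDerivUV φ s z = fderiv ℝ (fun v => fderiv ℝ h v (EuclideanSpace.single 0 1)) z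
      (EuclideanSpace.single 1 1) := by
  unfold coordDerivUV
  have h1 : ∀ v ∈ W, coordDeriv φ 0 s v = fderiv ℝ h v (EuclideanSpace.single 0 1) :=
    fun v hv => by
      have : (fun w => s (φ.symm w)) =ᶠ[𝓝 v] h := by
        filter_upwards [hW.mem_nhds hv] with w hw using hs w hw
      rw [coordDeriv, this.fderiv_eq]
  have h2 : coordDeriv φ 0 s =ᶠ[𝓝 z] fun v => fderiv ℝ h v (EuclideanSpace.single 0 1) := by
    filter_upwards [hW.mem_nhds hz] with v hv using h1 v hv
  rw [h2.fderiv_eq]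

variable [ChartedSpace (EuclideanSpace ℝ (Fin 2)) M]

theorem span_eq_of_det_eq_zero {F T : Fin 6 → ℝ} {α β r s : ℝ} (h0 : (α, β) ≠ 0)
    (h1 : (r, s) ≠ 0) (h : α * s - β * r = 0) :
    Submodule.span ℝ {α • F + β • T} = Submodule.span ℝ {r • F + s • T} := by
  obtain ⟨k, rfl, rfl⟩ := exists_smul_eq_of_det_eq_zero h0 h
  have hk : k ≠ 0 := fun hk => h1 (by simp [hk])
  have : (k * α) • F + (k * β) • T = k • (α • F + β • T) := by module
  rw [this, Submodule.span_singleton_smul_eq (IsUnit.mk0 k hk)]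

/-- A sphere congruence enveloped by the Legendre lift which takes values in a linear sphere
complex given by a vector in the span of `p` and `q` has constant coefficients. -/
theorem exists_coeff_of_takesValuesIn {p q : Fin 6 → ℝ} {f t : M → Fin 6 → ℝ}
    (hf : IsSpaceFormSurface p q f t) {w : Fin 6 → ℝ} (hw : w ∈ Submodule.span ℝ {p, q})
    (hw0 : w ≠ 0) {C : M → Submodule ℝ (Fin 6 → ℝ)} (hC : IsSphereCongruence C)
    (hCenv : Envelops (legendreLift f t) C) (hCw : TakesValuesIn C w) :
    ∃ m₀ m₁ : ℝ, (m₀, m₁) ≠ 0 ∧ ∀ y, C y = Submodule.span ℝ {m₀ • f y + m₁ • t y} := by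
  obtain ⟨l, m, rfl⟩ := Submodule.mem_span_pair.1 hw
  have hlm : (l, -m) ≠ 0 := fun h0 => hw0 (by
    obtain ⟨e1, e2⟩ := Prod.ext_iff.1 h0
    simp only [Prod.fst_zero, Prod.snd_zero, neg_eq_zero] at e1 e2
    simp [e1, e2])
  refine ⟨l, -m, hlm, fun y => ?_⟩
  obtain ⟨U, -, hyU, σ, hσ⟩ := hC y
  obtain ⟨hσ0, -, hCy⟩ := hσ.2 y hyU
  have hσC : σ y ∈ C y := hCy ▸ Submodule.mem_span_singleton_self _
  have hσeq := mem_legendreLift_eq hf (hCenv y hσC)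
  have h1 := hCw y _ hσC
  simp only [lieInner_add_right, lieInner_smul_right] at h1
  rw [hCy, hσeq]
  refine span_eq_of_det_eq_zero (fun h0 => hσ0 ?_) hlm (by linear_combination h1)
  obtain ⟨e1, e2⟩ := Prod.ext_iff.1 h0
  simp only [Prod.fst_zero, Prod.snd_zero] at e1 e2
  rw [hσeq, e1, e2]; simp

theorem span_eq_span_iff {p q : Fin 6 → ℝ} {f t : M → Fin 6 → ℝ}
    (hf : IsSpaceFormSurface p q f t) (y : M) {α β r s : ℝ} (h0 : (α, β) ≠ 0) (h1 : (r, s) ≠ 0) :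
    Submodule.span ℝ {r • f y + s • t y} = Submodule.span ℝ {α • f y + β • t y} ↔
      α * s - β * r = 0 := by
  refine ⟨fun h => ?_, fun h => (span_eq_of_det_eq_zero h0 h1 h).symm⟩
  have hmem : r • f y + s • t y ∈ Submodule.span ℝ {α • f y + β • t y} :=
    h ▸ Submodule.mem_span_singleton_self _
  obtain ⟨k, hk⟩ := Submodule.mem_span_singleton.1 hmem
  have h2 : (r - k * α) • f y + (s - k * β) • t y = 0 := by
    rw [← sub_eq_zero.2 hk.symm]; module
  have h3 : (r - k * α, s - k * β) = (0 : ℝ × ℝ) :=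
    by_contra fun h => combination_ne_zero hf y h h2
  obtain ⟨e1, e2⟩ := Prod.ext_iff.1 h3
  simp only [Prod.fst_zero, Prod.snd_zero] at e1 e2
  linear_combination α * e2 - β * e1

variable [IsManifold (𝓡 2) ∞ M]

theorem trans_mem_maximalAtlas (x : M)
    {ψ : OpenPartialHomeomorph (EuclideanSpace ℝ (Fin 2)) (EuclideanSpace ℝ (Fin 2))}
    (hψ : ContDiffOn ℝ ∞ ψ ψ.source) (hψs : ContDiffOn ℝ ∞ ψ.symm ψ.target) :
    (chartAt (EuclideanSpace ℝ (Fin 2)) x).trans ψ ∈ IsManifold.maximalAtlas (𝓡 2) ∞ M := by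
  refine OpenPartialHomeomorph.mem_maximalAtlas_of_contMDiffOn _ ?_ ?_
  · exact hψ.contMDiffOn.comp (contMDiffOn_chart.mono fun y hy => hy.1) fun y hy => hy.2
  · exact contMDiffOn_chart_symm.comp (hψs.contMDiffOn.mono fun y hy => hy.1) fun y hy => hy.2

/-- Away from the boundary of the coincidence set there are curvature line coordinates and lifts
with vanishing mixed second derivative. -/
theorem exists_curvatureLineCoord_moutardLift {p q : Fin 6 → ℝ} {f t : M → Fin 6 → ℝ}
    (hf : IsSpaceFormSurface p q f t) (humb : IsUmbilicFree (legendreLift f t))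
    (hLW : IsNonTubularLinearWeingarten p q (legendreLift f t))
    {S : M → Submodule ℝ (Fin 6 → ℝ)} (hS : IsChannelFamily (legendreLift f t) S)
    {w : Fin 6 → ℝ} (hw : w ∈ Submodule.span ℝ {p, q}) (hw0 : w ≠ 0)
    {C : M → Submodule ℝ (Fin 6 → ℝ)} (hC : IsSphereCongruence C)
    (hCenv : Envelops (legendreLift f t) C) (hCw : TakesValuesIn C w) {x : M}
    (hx : x ∉ frontier {x | C x = S x}) :
    ∃ φ ∈ IsManifold.maximalAtlas (𝓡 2) ∞ M, x ∈ φ.source ∧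
      IsCurvatureLineCoord (legendreLift f t) φ ∧
      ∃ σ, IsMoutardLift C φ σ ∧ ∀ z ∈ φ.target, coordDerivUV φ σ z = 0 := by
  obtain ⟨m₀, m₁, hm, hCm⟩ := exists_coeff_of_takesValuesIn hf hw hw0 hC hCenv hCw
  obtain ⟨V₀, hV₀, hxV₀, hdich⟩ : ∃ V₀ : Set M, IsOpen V₀ ∧ x ∈ V₀ ∧
      ((∀ y ∈ V₀, C y = S y) ∨ ∀ y ∈ V₀, C y ≠ S y) := by
    have h1 : x ∈ (frontier {x | C x = S x})ᶜ := hx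
    rw [compl_frontier_eq_union_interior] at h1
    rcases h1 with h1 | h1
    · exact ⟨_, isOpen_interior, h1, Or.inl fun y hy => (interior_subset hy : y ∈ {x | C x = S x})⟩
    · exact ⟨_, isOpen_interior, h1, Or.inr fun y hy => (interior_subset hy : y ∈ {x | C x = S x}ᶜ)⟩
  obtain ⟨U₀, hU₀, hxU₀, σ, hσ⟩ := hS.congruence x
  have hσV : IsLift S (V₀ ∩ U₀) σ :=
    ⟨hσ.1.mono Set.inter_subset_right, fun y hy => hσ.2 y hy.2⟩
  obtain ⟨a, b, c, hdet, hW⟩ := hLW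
  have hP := isChannelWeingartenPatch hf (isWeingartenPatch hf humb hdet hW x) hS
    (hV₀.inter hU₀) hσV
  set ch := chartAt (EuclideanSpace ℝ (Fin 2)) x with hch
  have hiff : ∀ z ∈ ch.target ∩ ch.symm ⁻¹' (V₀ ∩ U₀), C (ch.symm z) = S (ch.symm z) ↔
      -lieInner (σ (ch.symm z)) q * m₁ - -lieInner (σ (ch.symm z)) p * m₀ = 0 := fun z hz => by
    have hl := hσV.2 _ hz.2
    have hmem : σ (ch.symm z) ∈ legendreLift f t (ch.symm z) :=
      hS.envelops _ (by rw [hl.2.2]; exact Submodule.mem_span_singleton_self _)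
    rw [← span_eq_span_iff hf (ch.symm z) (hP.coeff_ne_zero z hz) hm, hCm, hl.2.2,
      ← mem_legendreLift_eq hf hmem]
  obtain ⟨ψ, hxψ, hψU, hψ, hψs, hcurv, g, hg, hg0, hgm⟩ :=
    hP.exists_moutard (z := ch x) (m₀ := m₀) (m₁ := m₁)
      ⟨mem_chart_target _ x, by
        rw [Set.mem_preimage, ch.left_inv (mem_chart_source _ x)]; exact ⟨hxV₀, hxU₀⟩⟩
      (hdich.imp (fun h z hz => (hiff z hz).1 (h _ hz.2.1))
        fun h z hz h0 => h _ hz.2.1 ((hiff z hz).2 h0))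
  have huv : ∀ z ∈ (ch.trans ψ).target, coordDerivUV (ch.trans ψ)
      (fun y => g (ch y) • (m₀ • f y + m₁ • t y)) z = 0 := fun z hz => by
    rw [coordDerivUV_congr (φ := ch.trans ψ) ψ.open_target (fun v hv => ?_) hz.1]
    · exact hgm z hz.1
    · simp only [OpenPartialHomeomorph.coe_trans_symm, Function.comp_apply]
      rw [ch.right_inv (hψU (ψ.map_target hv)).1]
  refine ⟨ch.trans ψ, trans_mem_maximalAtlas x hψ hψs, ⟨mem_chart_source _ x, hxψ⟩,
    fun z hz i => ?_, _, ⟨⟨?_, fun y hy => ⟨?_, ?_, ?_⟩⟩, fun z hz => ⟨0, ?_⟩⟩, huv⟩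
  · obtain ⟨r, s, hrs, h0⟩ := hcurv z hz.1 i
    refine ⟨_, isSection_combination hf r s, combination_ne_zero hf _ hrs, ?_⟩
    have : coordDeriv (ch.trans ψ) i (fun y => r • f y + s • t y) z = 0 := h0
    rw [this]
    exact Submodule.zero_mem _
  · exact (hg.contMDiffOn.comp (contMDiffOn_chart.mono fun y hy => hy.1) fun y hy => hy.2).smul
      (isSection_combination hf m₀ m₁).1.contMDiffOn
  · exact smul_ne_zero (hg0 _ hy.2) (combination_ne_zero hf y hm)
  · have hE := isContactElement_of_surface hf y
    simp only [lieInner_smul_left, lieInner_smul_right, lieInner_add_left, lieInner_add_right,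
      hE.point.1, hE.plane.1, hE.incident, lieInner_comm (t y) (f y)]
    ring
  · rw [hCm, Submodule.span_singleton_smul_eq (IsUnit.mk0 (g (ch y)) (hg0 _ hy.2))]
  · rw [huv z hz, zero_smul]

end Main

end LieSphere

end

theorem mainTheorem4 {M : Type*} [TopologicalSpace M]
    [ChartedSpace (EuclideanSpace ℝ (Fin 2)) M] [IsManifold (𝓡 2) ∞ M]
    (p q : Fin 6 → ℝ) (hp : LieSphere.IsPointSphereComplex p)
    (hq : LieSphere.IsSpaceFormVector p q)
    (f t : M → Fin 6 → ℝ) (hf : LieSphere.IsSpaceFormSurface p q f t)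
    (humb : LieSphere.IsUmbilicFree (LieSphere.legendreLift f t))
    (hLW : LieSphere.IsNonTubularLinearWeingarten p q (LieSphere.legendreLift f t))
    (S : M → Submodule ℝ (Fin 6 → ℝ))
    (hS : LieSphere.IsChannelFamily (LieSphere.legendreLift f t) S)
    (w : Fin 6 → ℝ) (hw : w ∈ Submodule.span ℝ {p, q}) (hw0 : w ≠ 0)
    (C : M → Submodule ℝ (Fin 6 → ℝ)) (hC : LieSphere.IsSphereCongruence C)
    (hCenv : LieSphere.Envelops (LieSphere.legendreLift f t) C)
    (hCw : LieSphere.TakesValuesIn C w) :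
    LieSphere.IsIsothermicOn C (frontier {x | C x = S x})ᶜ ∧
      ∀ x ∉ frontier {x | C x = S x},
        ∃ φ ∈ IsManifold.maximalAtlas (𝓡 2) ∞ M, x ∈ φ.source ∧
          LieSphere.IsCurvatureLineCoord (LieSphere.legendreLift f t) φ ∧
          ∃ σ, LieSphere.IsMoutardLift C φ σ ∧
            ∀ z ∈ φ.target, LieSphere.coordDerivUV φ σ z = 0 := by
  have main := fun x hx => LieSphere.exists_curvatureLineCoord_moutardLift (x := x) hf humb hLW hS
    hw hw0 hC hCenv hCw hx
  refine ⟨fun x hx => ?_, main⟩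
  obtain ⟨φ, hφ, hxφ, -, σ, hσ, -⟩ := main x hx
  exact ⟨φ, hφ, hxφ, σ, hσ⟩
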